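/- Consider oriented link diagrams in the plane. Up to planar isotopy there are sixteen oriented Reidemeister moves, each of which may be used in both directions. *Type 1.* $\Omega 1a,\Omega 1b$ create or remove a loop at a positive crossing, and $\Omega 1c,\Omega 1d$ a loop at a negative crossing; the loop is clockwise for $\Omega 1a,\Omega 1c$ and counter-clockwise for $\Omega 1b,\Omega 1d$. *Type 2.* These create or remove two crossings that bound a bigon, one strand lying over the other. In $\Omega 2c$ (respectively $\Omega 2d$) the bigon is oriented counter-clockwise (respectively clockwise). In $\Omega 2a,\Omega 2b$ both edges of the bigon run from one crossing to the other, and the first crossing is positive for $\Omega 2a$ and negative for $\Omega 2b$. *Type 3.* These slide a strand over or under a crossing of two other strands, the three crossings bounding a triangle. The triangle is well-oriented (its three edges form an oriented cycle) exactly for $\Omega 3a$ (two positive crossings, one negative) and $\Omega 3h$ (one positive, two negative). It is not well-oriented for the others: $\Omega 3b$ (three positive crossings); $\Omega 3g$ (three negative); $\Omega 3d$ and $\Omega 3e$ (two positive and one negative, a strand sliding over, respectively under, the negative crossing); $\Omega 3c$ and $\Omega 3f$ (one positive and two negative, a strand sliding over, respectively under, the positive crossing). A set $S$ of oriented Reidemeister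 moves is *generating* if every oriented Reidemeister move $\Omega$ can be realized by a finite sequence of planar isotopies and moves in $S$, performed inside the localized disk of $\Omega$ (the disk in which $\Omega$ takes place). A generating set $S$ is *minimal* if there is no generating set $R$ with $|R|<|S|$. **Theorem.** Every minimal generating set of oriented Reidemeister moves contains $\Omega 3a$ or $\Omega 3h$. -/

import Mathlib

/-!
# Oriented tangle diagrams in a disk and the oriented Reidemeister moves

A generic diagram of `n` oriented arcs in a disk, with its end points on the boundary circle, is
recorded by its signed Gauss code together with the cyclic order of the end points on the circle.
The arcs and the boundary circle form a connected graph embedded in the plane; the code records the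
rotation system of that graph, and the code comes from a diagram in the disk exactly when the
Euler characteristic computed from its faces is that of the sphere.
Since the graph is connected, two diagrams in the disk are related by a planar isotopy that fixes
the boundary exactly when their codes agree up to the names of the crossings.  Reidemeister moves
keep the number of components, so a sequence of moves inside the localized disk of a move never
meets a diagram with closed components.
-/

namespace ReidemeisterMoves

/-- A passage of a strand through a crossing: the name of the crossing, whether the strand is the
over-strand there, and whether the crossing is positive. -/
structure Passage where
  crossing : ℕ
  isOver : Bool
  positive : Bool
deriving DecidableEq

namespace Passage

/-- The passage of the other strand through the same crossing. -/
def other (p : Passage) : Passage := ⟨p.crossing, !p.isOver, p.positive⟩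

/-- At the passage `p`, the other strand crosses from the right of this strand to its left.
(At a positive crossing the under-strand crosses the over-strand from right to left.) -/
def fromRight (p : Passage) : Bool := p.isOver == p.positive

/-- Rename the crossing. -/
def rename (σ : Equiv.Perm ℕ) (p : Passage) : Passage := ⟨σ p.crossing, p.isOver, p.positive⟩

end Passage

/-- The vertices of a diagram, each seen from a strand through it: `endpoint i b` is the initial
(`b = false`) or terminal (`b = true`) point of strand `i` on the boundary circle. -/
inductive Node (n : ℕ) where
  | endpoint (i : Fin n) (b : Bool)
  | passage (p : Passage)
deriving DecidableEq

/-- A dart `(a, f)` is an edge of the strands leaving the node `a`, in the direction of the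
orientation of the strand if `f = true` and against it if `f = false`. -/
abbrev Dart (n : ℕ) := Node n × Bool

/-- Whether a strand leaves the node in the given direction: at a passage it does so in both
directions, at an end point only in the direction into the disk. -/
def Node.leaves {n : ℕ} : Node n → Bool → Bool
  | .endpoint _ b, f => f == !b
  | .passage _, _ => true

/-- A signed Gauss code of `n` arcs: the passages met along each strand, and the list of all end
points in the counter-clockwise order in which they lie on the boundary circle. -/
@[ext] structure TangleCode (n : ℕ) where
  strand : Fin n → List Passage
  boundary : List (Fin n × Bool)

namespace TangleCode

variable {n : ℕ}

/-- All passages. -/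
def passages (T : TangleCode n) : List Passage := (List.finRange n).flatMap T.strand

/-- The set of crossings. -/
def crossings (T : TangleCode n) : Finset ℕ := (T.passages.map Passage.crossing).toFinset

/-- The nodes along the strands, strand after strand. -/
def nodes (T : TangleCode n) : List (Node n) :=
  (List.finRange n).flatMap fun i =>
    Node.endpoint i false :: ((T.strand i).map Node.passage ++ [Node.endpoint i true])

/-- The node that follows `a` on its strand (used unless `a` is a terminal point). -/
def next (T : TangleCode n) (a : Node n) : Node n := T.nodes.getD (T.nodes.idxOf a + 1) a

/-- The node that precedes `a` on its strand (used unless `a` is an initial point). -/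
def prev (T : TangleCode n) (a : Node n) : Node n := T.nodes.getD (T.nodes.idxOf a - 1) a

/-- The end point that follows `e` counter-clockwise on the boundary circle. -/
def boundaryNext (T : TangleCode n) (e : Fin n × Bool) : Fin n × Bool :=
  T.boundary.getD ((T.boundary.idxOf e + 1) % T.boundary.length) e

/-- All darts: both directions at a passage, only the direction into the disk at an end point. -/
def darts (T : TangleCode n) : Finset (Dart n) :=
  (T.nodes.toFinset ×ˢ Finset.univ).filter fun d => d.1.leaves d.2 = true

/-- Walk along the edge of a dart with the face on the left-hand side, and turn left at its end.
At a crossing this leads to the other strand; at the boundary circle it leads along the circle,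
counter-clockwise, to the next end point and from there into the disk again. -/
def faceNext (T : TangleCode n) (d : Dart n) : Dart n :=
  match (if d.2 then T.next d.1 else T.prev d.1) with
  | .passage p => (.passage p.other, d.2 == p.fromRight)
  | .endpoint i b => (.endpoint (T.boundaryNext (i, b)).1 (T.boundaryNext (i, b)).2,
      !(T.boundaryNext (i, b)).2)

/-- The darts on the boundary of the face to the left of `d`. -/
def face (T : TangleCode n) (d : Dart n) : Finset (Dart n) :=
  (Finset.range T.darts.card).image fun k => T.faceNext^[k] d

/-- The faces inside the disk. -/
def faces (T : TangleCode n) : Finset (Finset (Dart n)) := T.darts.image T.face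

/-- `T` is the code of a diagram of `n ≥ 1` oriented arcs in the disk: every crossing is passed
once over and once under, every end point is listed once, and the code is planar.  The graph formed
by the strands and the boundary circle is connected; with `c` crossings it has `c + 2 n` vertices
and `(2 c + n) + 2 n` edges, so with the face outside the disk Euler's formula says that there are
`c + n + 1` faces inside the disk. -/
structure IsDiagram (T : TangleCode n) : Prop where
  nodup : T.passages.Nodup
  other_mem : ∀ p ∈ T.passages, p.other ∈ T.passages
  sign_eq : ∀ p ∈ T.passages, ∀ q ∈ T.passages, p.crossing = q.crossing → p.positive = q.positive
  boundary_nodup : T.boundary.Nodup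
  mem_boundary : ∀ e : Fin n × Bool, e ∈ T.boundary
  planar : T.faces.card = T.crossings.card + n + 1

/-- Planar isotopy of the disk fixing the boundary: the codes agree up to renaming crossings. -/
def Isotopic (T T' : TangleCode n) : Prop :=
  T'.boundary = T.boundary ∧
    ∃ σ : Equiv.Perm ℕ, ∀ i, T'.strand i = (T.strand i).map (Passage.rename σ)

/-- Remove the crossings in `s`. -/
def erase (T : TangleCode n) (s : List ℕ) : TangleCode n where
  strand i := (T.strand i).filter fun p => p.crossing ∉ s
  boundary := T.boundary

/-- Apply a permutation of the passages. -/
def permute (T : TangleCode n) (σ : Equiv.Perm Passage) : TangleCode n where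
  strand i := (T.strand i).map σ
  boundary := T.boundary

/-- `T` has a face whose vertices are distinct crossings, and `l` lists the darts that one follows
when walking once around it counter-clockwise.  The edge that leaves from an entry `(p, f)` of `l`
ends in the passage `q.other`, where `(q, g)` is the cyclically next entry; the interior of the face
is on the left, and the edge is walked along its orientation exactly if `f = true`. -/
def HasFace (T : TangleCode n) (l : List (Passage × Bool)) : Prop :=
  (l.map fun d => d.1.crossing).Nodup ∧ (∀ d ∈ l, d.1 ∈ T.passages) ∧
    l.map (fun d => T.faceNext (Node.passage d.1, d.2)) =
      (l.map fun d => (Node.passage d.1, d.2)).rotate 1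

end TangleCode

/-- The sixteen oriented Reidemeister moves. -/
inductive Move where
  | Ω1a | Ω1b | Ω1c | Ω1d
  | Ω2a | Ω2b | Ω2c | Ω2d
  | Ω3a | Ω3b | Ω3c | Ω3d | Ω3e | Ω3f | Ω3g | Ω3h
deriving DecidableEq

namespace Move

/-- Type 1, named by the crossing `p` and the orientation of the loop, which is counter-clockwise
if `f = true` and clockwise if `f = false`. -/
def OfMonogon (p : Passage) (f : Bool) : Move → Prop
  | Ω1a => p.positive = true ∧ f = false
  | Ω1b => p.positive = true ∧ f = true
  | Ω1c => p.positive = false ∧ f = false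
  | Ω1d => p.positive = false ∧ f = true
  | _ => False

/-- Type 2, for a bigon with darts `(p, f)`, `(q, g)`: counter-clockwise oriented (`Ω2c`),
clockwise oriented (`Ω2d`), or disoriented with both edges running from the crossing of `p` to the
crossing of `q`, the first crossing being positive (`Ω2a`) or negative (`Ω2b`). -/
def OfBigon (p : Passage) (f g : Bool) : Move → Prop
  | Ω2a => f = true ∧ g = false ∧ p.positive = true
  | Ω2b => f = true ∧ g = false ∧ p.positive = false
  | Ω2c => f = true ∧ g = true
  | Ω2d => f = false ∧ g = false
  | _ => False

/-- Type 3, for a triangle with darts `(p, f)`, `(q, g)`, `(r, h)` whose first edge (from `p` to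
`q.other`) belongs to the strand that lies over the two others.  The top strand slides over the
crossing of `r`.  The bottom strand contains the second edge if `r` is an over-passage, and then it
slides under the crossing of `p`; otherwise it contains the third edge, and it slides under the
crossing of `q`. -/
def OfTriangle (p q r : Passage) (f g h : Bool) (m : Move) : Prop :=
  let wellOriented : Prop := f = g ∧ g = h
  let positives : ℕ := [p, q, r].countP Passage.positive
  let overCrossing : Passage := r
  let underCrossing : Passage := if r.isOver then p else q
  match m with
  | Ω3a => wellOriented ∧ positives = 2
  | Ω3b => ¬ wellOriented ∧ positives = 3
  | Ω3c => ¬ wellOriented ∧ positives = 1 ∧ overCrossing.positive = true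
  | Ω3d => ¬ wellOriented ∧ positives = 2 ∧ overCrossing.positive = false
  | Ω3e => ¬ wellOriented ∧ positives = 2 ∧ underCrossing.positive = false
  | Ω3f => ¬ wellOriented ∧ positives = 1 ∧ underCrossing.positive = true
  | Ω3g => ¬ wellOriented ∧ positives = 0
  | Ω3h => wellOriented ∧ positives = 1
  | _ => False

/-- `m.Step T T'`: the oriented Reidemeister move `m`, applied somewhere in the diagram `T`, gives
`T'`.  Moves of type 1 and 2 are applied in the direction that removes crossings.
* Type 1 removes the crossing of a one-sided face.
* Type 2 removes the crossings of a two-sided face one of whose edges lies over the other.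
* Type 3 inverts a three-sided face one of whose edges lies over the two others, and one of whose
  edges lies under the two others (for a triangle this means that the edges do not lie cyclically
  over each other): on each of the three strands the two crossings are interchanged. -/
def Step {n : ℕ} (m : Move) (T T' : TangleCode n) : Prop :=
  (∃ p f, T.HasFace [(p, f)] ∧ m.OfMonogon p f ∧ T' = T.erase [p.crossing]) ∨
  (∃ p q f g, T.HasFace [(p, f), (q, g)] ∧ p.isOver ≠ q.isOver ∧ m.OfBigon p f g ∧
    T' = T.erase [p.crossing, q.crossing]) ∨
  (∃ p q r f g h, T.HasFace [(p, f), (q, g), (r, h)] ∧ p.isOver = true ∧ q.isOver = false ∧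
    m.OfTriangle p q r f g h ∧
    T' = T.permute
      (Equiv.swap p q.other * (Equiv.swap q r.other * Equiv.swap r p.other)))

/-- The number of strands in the localized disk of a move. -/
def strands : Move → ℕ
  | Ω1a | Ω1b | Ω1c | Ω1d => 1
  | Ω2a | Ω2b | Ω2c | Ω2d => 2
  | Ω3a | Ω3b | Ω3c | Ω3d | Ω3e | Ω3f | Ω3g | Ω3h => 3

end Move

/-- Over-passage at crossing `c`, for the pictures below. -/
abbrev ov (c : ℕ) (positive : Bool) : Passage := ⟨c, true, positive⟩

/-- Under-passage at crossing `c`, for the pictures below. -/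
abbrev un (c : ℕ) (positive : Bool) : Passage := ⟨c, false, positive⟩

namespace Move

/-- The diagram on one side of a move, inside the localized disk of the move: the side with more
crossings for types 1 and 2.  For type 2, strand `0` is over strand `1`.  For type 3, strand `0` is
the top, strand `1` the middle and strand `2` the bottom strand; crossing `0` is between top and
middle, crossing `1` between top and bottom, crossing `2` between middle and bottom. -/
def source : (m : Move) → TangleCode m.strands
  | Ω1a => (⟨![[ov 0 true, un 0 true]], [(0, false), (0, true)]⟩ : TangleCode 1)
  | Ω1b => (⟨![[un 0 true, ov 0 true]], [(0, false), (0, true)]⟩ : TangleCode 1)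
  | Ω1c => (⟨![[un 0 false, ov 0 false]], [(0, false), (0, true)]⟩ : TangleCode 1)
  | Ω1d => (⟨![[ov 0 false, un 0 false]], [(0, false), (0, true)]⟩ : TangleCode 1)
  | Ω2a => (⟨![[ov 0 true, ov 1 false], [un 0 true, un 1 false]],
      [(0, false), (1, false), (1, true), (0, true)]⟩ : TangleCode 2)
  | Ω2b => (⟨![[ov 0 false, ov 1 true], [un 0 false, un 1 true]],
      [(0, false), (0, true), (1, true), (1, false)]⟩ : TangleCode 2)
  | Ω2c => (⟨![[ov 0 false, ov 1 true], [un 1 true, un 0 false]],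
      [(0, false), (1, true), (1, false), (0, true)]⟩ : TangleCode 2)
  | Ω2d => (⟨![[ov 0 true, ov 1 false], [un 1 false, un 0 true]],
      [(0, false), (0, true), (1, false), (1, true)]⟩ : TangleCode 2)
  | Ω3a => (⟨![[ov 0 true, ov 1 false], [ov 2 true, un 0 true], [un 1 false, un 2 true]],
      [(0, false), (2, true), (1, false), (0, true), (2, false), (1, true)]⟩ : TangleCode 3)
  | Ω3b => (⟨![[ov 0 true, ov 1 true], [un 0 true, ov 2 true], [un 1 true, un 2 true]],
      [(0, false), (1, false), (2, false), (0, true), (1, true), (2, true)]⟩ : TangleCode 3)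
  | Ω3c => (⟨![[ov 0 false, ov 1 false], [ov 2 true, un 0 false], [un 2 true, un 1 false]],
      [(0, false), (1, true), (2, true), (0, true), (1, false), (2, false)]⟩ : TangleCode 3)
  | Ω3d => (⟨![[ov 0 true, ov 1 true], [ov 2 false, un 0 true], [un 2 false, un 1 true]],
      [(0, false), (2, false), (1, false), (0, true), (2, true), (1, true)]⟩ : TangleCode 3)
  | Ω3e => (⟨![[ov 0 false, ov 1 true], [un 0 false, ov 2 true], [un 2 true, un 1 true]],
      [(0, false), (2, false), (1, true), (0, true), (2, true), (1, false)]⟩ : TangleCode 3)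
  | Ω3f => (⟨![[ov 0 true, ov 1 false], [un 0 true, ov 2 false], [un 2 false, un 1 false]],
      [(0, false), (1, false), (2, true), (0, true), (1, true), (2, false)]⟩ : TangleCode 3)
  | Ω3g => (⟨![[ov 0 false, ov 1 false], [un 0 false, ov 2 false], [un 1 false, un 2 false]],
      [(0, false), (2, true), (1, true), (0, true), (2, false), (1, false)]⟩ : TangleCode 3)
  | Ω3h => (⟨![[ov 0 false, ov 1 true], [ov 2 false, un 0 false], [un 1 true, un 2 false]],
      [(0, false), (1, true), (2, false), (0, true), (1, false), (2, true)]⟩ : TangleCode 3)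

/-- The diagram on the other side of the move: the strands without crossings for types 1 and 2,
the two crossings on each strand interchanged for type 3. -/
def target (m : Move) : TangleCode m.strands where
  strand i := if m.strands = 3 then (m.source.strand i).reverse else []
  boundary := m.source.boundary

end Move

namespace TangleCode

variable {n : ℕ}

theorem isDiagram_iff (T : TangleCode n) : T.IsDiagram ↔
    T.passages.Nodup ∧ (∀ p ∈ T.passages, p.other ∈ T.passages) ∧
    (∀ p ∈ T.passages, ∀ q ∈ T.passages, p.crossing = q.crossing → p.positive = q.positive) ∧
    T.boundary.Nodup ∧ (∀ e : Fin n × Bool, e ∈ T.boundary) ∧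
    T.faces.card = T.crossings.card + n + 1 :=
  ⟨fun h => ⟨h.1, h.2, h.3, h.4, h.5, h.6⟩, fun ⟨h₁, h₂, h₃, h₄, h₅, h₆⟩ =>
    ⟨h₁, h₂, h₃, h₄, h₅, h₆⟩⟩

instance (T : TangleCode n) : Decidable T.IsDiagram := decidable_of_iff _ T.isDiagram_iff.symm

instance (T : TangleCode n) (l : List (Passage × Bool)) : Decidable (T.HasFace l) := by
  unfold HasFace; infer_instance

end TangleCode

namespace Move

theorem source_isDiagram (m : Move) : m.source.IsDiagram := by
  cases m <;> decide +kernel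

theorem target_isDiagram (m : Move) : m.target.IsDiagram := by
  cases m <;> decide +kernel

/-- The two sides of the localized disk are indeed related by the move. -/
theorem step_source_target (m : Move) : m.Step m.source m.target := by
  cases m
  · exact .inl ⟨un 0 true, false, by decide, by simp [OfMonogon],
      TangleCode.ext (by decide) rfl⟩
  · exact .inl ⟨un 0 true, true, by decide, by simp [OfMonogon],
      TangleCode.ext (by decide) rfl⟩
  · exact .inl ⟨ov 0 false, false, by decide, by simp [OfMonogon],
      TangleCode.ext (by decide) rfl⟩
  · exact .inl ⟨ov 0 false, true, by decide, by simp [OfMonogon],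
      TangleCode.ext (by decide) rfl⟩
  · exact .inr (.inl ⟨ov 0 true, un 1 false, true, false, by decide, by decide, by simp [OfBigon],
      TangleCode.ext (by decide) rfl⟩)
  · exact .inr (.inl ⟨un 0 false, ov 1 true, true, false, by decide, by decide, by simp [OfBigon],
      TangleCode.ext (by decide) rfl⟩)
  · exact .inr (.inl ⟨ov 0 false, un 1 true, true, true, by decide, by decide, by simp [OfBigon],
      TangleCode.ext (by decide) rfl⟩)
  · exact .inr (.inl ⟨ov 1 false, un 0 true, false, false, by decide, by decide, by simp [OfBigon],
      TangleCode.ext (by decide) rfl⟩)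
  · exact .inr (.inr ⟨ov 1 false, un 0 true, un 2 true, false, false, false, by decide, rfl, rfl,
      by simp [OfTriangle],
      TangleCode.ext (by decide) rfl⟩)
  · exact .inr (.inr ⟨ov 0 true, un 1 true, ov 2 true, true, true, false, by decide, rfl, rfl,
      by simp [OfTriangle],
      TangleCode.ext (by decide) rfl⟩)
  · exact .inr (.inr ⟨ov 0 false, un 1 false, ov 2 true, true, false, true, by decide, rfl, rfl,
      by simp [OfTriangle],
      TangleCode.ext (by decide) rfl⟩)
  · exact .inr (.inr ⟨ov 1 true, un 0 true, un 2 false, false, false, true, by decide, rfl, rfl,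
      by simp [OfTriangle],
      TangleCode.ext (by decide) rfl⟩)
  · exact .inr (.inr ⟨ov 1 true, un 0 false, un 2 true, false, true, true, by decide, rfl, rfl,
      by simp [OfTriangle],
      TangleCode.ext (by decide) rfl⟩)
  · exact .inr (.inr ⟨ov 0 true, un 1 false, ov 2 false, true, false, false, by decide, rfl, rfl,
      by simp [OfTriangle],
      TangleCode.ext (by decide) rfl⟩)
  · exact .inr (.inr ⟨ov 1 false, un 0 false, un 2 false, false, true, false, by decide, rfl, rfl,
      by simp [OfTriangle],
      TangleCode.ext (by decide) rfl⟩)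
  · exact .inr (.inr ⟨ov 0 false, un 1 true, ov 2 false, true, true, true, by decide, rfl, rfl,
      by simp [OfTriangle],
      TangleCode.ext (by decide) rfl⟩)

/-- `S` realizes `m`: inside the localized disk of `m`, one side of `m` is connected with the other
side by a finite sequence of planar isotopies and moves in `S`, applied in either direction. -/
def RealizedBy (m : Move) (S : Finset Move) : Prop :=
  Relation.EqvGen
    (fun D D' : {T : TangleCode m.strands // T.IsDiagram} =>
      TangleCode.Isotopic D.1 D'.1 ∨ ∃ k ∈ S, k.Step D.1 D'.1)
    ⟨m.source, m.source_isDiagram⟩ ⟨m.target, m.target_isDiagram⟩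

end Move

/-- A generating set of oriented Reidemeister moves: every oriented move is realized by it. -/
def IsGenerating (S : Finset Move) : Prop := ∀ m : Move, m.RealizedBy S

/-- A minimal generating set: no generating set has fewer elements. -/
def IsMinimalGenerating (S : Finset Move) : Prop :=
  IsGenerating S ∧ ¬ ∃ R : Finset Move, IsGenerating R ∧ R.card < S.card

end ReidemeisterMoves

namespace ReidemeisterMoves

/-! ### Counting faces -/

namespace TangleCode

variable {n : ℕ}

/-! A four-element generating set is compared with four kinds of moves that no generating set can
avoid.

The moves Ω1a, Ω1b, Ω2a, Ω3a generate (`isGenerating_basicMoves`): explicit sequences produce the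
twelve others, and every step, including planarity of the intermediate diagrams, is checked by
evaluation. So a minimal generating set has at most four elements. Conversely, invariants show that
a generating set needs a loop first passed over, a loop first passed under, a move of type 2 and a
move of type 3 (`exists_loop`, `exists_bigon`, `exists_triangle`). A minimal set therefore contains
exactly one move of each of these kinds.

Suppose its move of type 3 is not well-oriented. Then the top strand or the bottom strand of the
triangle meets two crossings of the same sign (`exists_sameSign`). In a diagram with two strands,
read along one strand the signs at its over-passages (respectively under-passages) with the other
strand, as a word in the bicyclic monoid, where `ab = 1` but `ba ≠ 1`. Loops contribute nothing. The
only available move of type 2 inserts or removes the two signs in one fixed order, say `ab`. The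
move of type 3 interchanges equal letters, or a letter with `1`. The word is thus invariant, yet one
of Ω2a, Ω2b would force `ba = 1` (`not_isGenerating_of_sameSign`).

All invariants are products of letters along a strand (`Weight`). `Weight.word_step` reduces
invariance to conditions on the letters at a loop, a bigon and a triangle; `consec_of_faceNext`
supplies the adjacencies on the strands by reading them off the faces. -/

theorem face_eq_of_cycle (T : TangleCode n) (l : List (Dart n))
    (hl : l.map T.faceNext = l.rotate 1) (hle : l.length ≤ T.darts.card) {d : Dart n}
    (hd : d ∈ l) : T.face d = l.toFinset := by
  have hpos : 0 < l.length := List.length_pos_of_mem hd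
  have hstep : ∀ j (hj : j < l.length), T.faceNext l[j] =
      l[(j + 1) % l.length]'(Nat.mod_lt _ hpos) := by
    intro j hj
    have h1 : (l.map T.faceNext)[j]'(by simpa using hj) = T.faceNext l[j] := by simp
    rw [← h1]
    simp only [hl, List.getElem_rotate]
  obtain ⟨j, hj, rfl⟩ := List.getElem_of_mem hd
  have hiter : ∀ k, T.faceNext^[k] l[j] = l[(j + k) % l.length]'(Nat.mod_lt _ hpos) := by
    intro k
    induction k with
    | zero => simp [Nat.mod_eq_of_lt hj]
    | succ k ih =>
      rw [Function.iterate_succ_apply', ih, hstep]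
      congr 1
      rw [Nat.mod_add_mod, Nat.add_assoc]
  ext x
  simp only [face, Finset.mem_image, Finset.mem_range, List.mem_toFinset]
  constructor
  · rintro ⟨k, -, rfl⟩
    rw [hiter]
    exact List.getElem_mem _
  · intro hx
    obtain ⟨i, hi, rfl⟩ := List.getElem_of_mem hx
    -- Going round the cycle from position `j` to position `i` takes this many steps; the reduction
    -- keeps the exponent within the iterates that define `face`.
    refine ⟨(i + (l.length - j)) % l.length, (Nat.mod_lt _ hpos).trans_le hle, ?_⟩
    rw [hiter]
    congr 1
    rw [Nat.add_mod_mod, show j + (i + (l.length - j)) = i + l.length by omega,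
      Nat.add_mod_right, Nat.mod_eq_of_lt hi]

/-- If the darts are partitioned into cycles of `faceNext`, the faces are the cycles. -/
theorem card_faces_of_cycles (T : TangleCode n) (cs : List (List (Dart n)))
    (hne : ∀ l ∈ cs, l ≠ []) (hcyc : ∀ l ∈ cs, l.map T.faceNext = l.rotate 1)
    (hcover : ∀ d ∈ T.darts, d ∈ cs.flatten) (hcard : cs.flatten.length = T.darts.card) :
    T.faces.card = cs.length := by
  have hsub : T.darts ⊆ cs.flatten.toFinset := fun d hd => List.mem_toFinset.2 (hcover d hd)
  have hle : cs.flatten.toFinset.card ≤ T.darts.card :=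
    hcard ▸ List.toFinset_card_le _
  have heq : T.darts = cs.flatten.toFinset := Finset.eq_of_subset_of_card_le hsub hle
  -- The cycles cover all darts with exactly as many entries as there are darts, so nothing is
  -- repeated and distinct cycles are disjoint.
  have hnd : cs.flatten.Nodup := by
    rw [← Multiset.coe_nodup, ← Multiset.toFinset_card_eq_card_iff_nodup]
    change cs.flatten.toFinset.card = cs.flatten.length
    rw [← heq, hcard]
  have hlen : ∀ l ∈ cs, l.length ≤ T.darts.card := fun l hl => by
    rw [← hcard]
    exact (List.sublist_flatten_of_mem hl).length_le
  have hface : ∀ l ∈ cs, ∀ d ∈ l, T.face d = l.toFinset := fun l hl d hd =>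
    T.face_eq_of_cycle l (hcyc l hl) (hlen l hl) hd
  have hfaces : T.faces = (cs.map List.toFinset).toFinset := by
    ext s
    simp only [faces, heq, Finset.mem_image, List.mem_toFinset, List.mem_flatten, List.mem_map]
    constructor
    · rintro ⟨d, ⟨l, hl, hd⟩, rfl⟩
      exact ⟨l, hl, (hface l hl d hd).symm⟩
    · rintro ⟨l, hl, rfl⟩
      obtain ⟨d, hd⟩ := List.exists_mem_of_ne_nil l (hne l hl)
      exact ⟨d, ⟨l, hl, hd⟩, hface l hl d hd⟩
  rw [hfaces, List.toFinset_card_of_nodup, List.length_map]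
  rw [List.nodup_flatten] at hnd
  refine List.Pairwise.map _ ?_ (List.Pairwise.and_mem.1 hnd.2)
  rintro l l' ⟨hl, hl', hdis⟩ h
  obtain ⟨d, hd⟩ := List.exists_mem_of_ne_nil l (hne l hl)
  exact hdis hd (List.mem_toFinset.1 (h ▸ List.mem_toFinset.2 hd))

end TangleCode

/-! ### Evaluation of lists of passages in normal form -/

/-- `k x`, arranged so that `x` is evaluated first. -/
def Passage.force {β : Type} (x : Passage) (k : Passage → β) : β :=
  match x with
  | ⟨c, true, true⟩ => k ⟨c, true, true⟩
  | ⟨c, true, false⟩ => k ⟨c, true, false⟩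
  | ⟨c, false, true⟩ => k ⟨c, false, true⟩
  | ⟨c, false, false⟩ => k ⟨c, false, false⟩

/-- Forcing changes only the order of evaluation: the kernel then computes with passages in
constructor form instead of growing unevaluated terms. -/
theorem Passage.force_eq {β : Type} (x : Passage) (k : Passage → β) : x.force k = k x := by
  rcases x with ⟨c, _ | _, _ | _⟩ <;> rfl

/-- `k l`, arranged so that `l` and its entries are evaluated first. -/
def forceList {α β : Type} (force : α → (α → β) → β) : List α → (List α → β) → β
  | [], k => k []
  | x :: l, k => force x fun y => forceList force l fun m => k (y :: m)

theorem forceList_eq {α β : Type} {force : α → (α → β) → β} (hf : ∀ x k, force x k = k x)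
    (l : List α) (k : List α → β) : forceList force l k = k l := by
  induction l generalizing k with
  | nil => rfl
  | cons x l ih => simp [forceList, hf, ih]

/-- `k d`, arranged so that `d` is evaluated first. -/
def Dart.force {n : ℕ} {β : Type} (d : Dart n) (k : Dart n → β) : β :=
  match d with
  | (.endpoint i true, true) => k (.endpoint i true, true)
  | (.endpoint i true, false) => k (.endpoint i true, false)
  | (.endpoint i false, true) => k (.endpoint i false, true)
  | (.endpoint i false, false) => k (.endpoint i false, false)
  | (.passage p, true) => p.force fun p => k (.passage p, true)
  | (.passage p, false) => p.force fun p => k (.passage p, false)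

theorem Dart.force_eq {n : ℕ} {β : Type} (d : Dart n) (k : Dart n → β) : Dart.force d k = k d := by
  rcases d with ⟨⟨i, _ | _⟩ | p, _ | _⟩ <;> simp [Dart.force, Passage.force_eq]

/-! ### A checkable Euler formula -/

namespace TangleCode

variable {n : ℕ}

/-- The list of darts. -/
def dartList (T : TangleCode n) : List (Dart n) :=
  T.nodes.flatMap fun a => [(a, true), (a, false)].filter fun d => d.1.leaves d.2

/-- Follow `faceNext` from `d` until `d₀` is reached, for at most `fuel` steps. -/
def walk (T : TangleCode n) (d₀ : Dart n) : ℕ → Dart n → List (Dart n)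
  | 0, _ => []
  | fuel + 1, d => Dart.force (T.faceNext d) fun d' =>
      d :: if d' = d₀ then [] else T.walk d₀ fuel d'

/-- Extend a list of cycles by the cycles of the darts in a list. -/
def collect (T : TangleCode n) (fuel : ℕ) : List (Dart n) → List (List (Dart n)) →
    (List (List (Dart n)) → Bool) → Bool
  | [], cs, k => k cs
  | d :: ds, cs, k =>
    bif cs.any fun l => decide (d ∈ l) then T.collect fuel ds cs k
    else Dart.force d fun d => forceList Dart.force (T.walk d fuel d) fun l =>
      bif decide (l.map T.faceNext = l.rotate 1) && decide (d ∈ l) then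
        T.collect fuel ds (l :: cs) k
      else false

/-- A test for the Euler formula. -/
def planarCheck (T : TangleCode n) : Bool :=
  T.collect T.dartList.length T.dartList [] fun cs =>
    cs.flatten.length == T.darts.card && cs.length == T.crossings.card + n + 1

/-- Each cycle is certified when it is added: a walk that runs out of fuel before closing up fails
the rotation test. Hence nothing has to be proved about `walk` itself. -/
theorem collect_spec (T : TangleCode n) (fuel : ℕ) (ds : List (Dart n))
    (cs : List (List (Dart n))) (k : List (List (Dart n)) → Bool)
    (hne : ∀ l ∈ cs, l ≠ []) (hcyc : ∀ l ∈ cs, l.map T.faceNext = l.rotate 1)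
    (h : T.collect fuel ds cs k = true) :
    ∃ cs', k cs' = true ∧ (∀ l ∈ cs', l ≠ []) ∧ (∀ l ∈ cs', l.map T.faceNext = l.rotate 1) ∧
      (∀ d ∈ ds, d ∈ cs'.flatten) ∧ ∀ d ∈ cs.flatten, d ∈ cs'.flatten := by
  induction ds generalizing cs with
  | nil => exact ⟨cs, h, hne, hcyc, by simp, fun _ h => h⟩
  | cons d ds ih =>
    simp only [collect, Dart.force_eq, forceList_eq Dart.force_eq, cond_eq_ite] at h
    split_ifs at h with h1 h2
    · obtain ⟨cs', a, b, c, e, f⟩ := ih cs hne hcyc h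
      refine ⟨cs', a, b, c, ?_, f⟩
      rintro x (_ | ⟨_, hx⟩)
      · apply f
        simpa using h1
      · exact e x hx
    · rw [Bool.and_eq_true, decide_eq_true_eq, decide_eq_true_eq] at h2
      obtain ⟨cs', a, b, c, e, f⟩ := ih _
        (by rintro l (_ | ⟨_, hl⟩)
            · exact List.ne_nil_of_mem h2.2
            · exact hne l hl)
        (by rintro l (_ | ⟨_, hl⟩)
            · exact h2.1
            · exact hcyc l hl) h
      refine ⟨cs', a, b, c, ?_, fun x hx => f x (by simp [List.mem_flatten.1 hx])⟩
      rintro x (_ | ⟨_, hx⟩)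
      · exact f d (by simp [h2.2])
      · exact e x hx

/-- The faces are counted through the list of cycles, so the finset of finsets `faces` is never
evaluated. -/
theorem planar_of_planarCheck (T : TangleCode n) (h : T.planarCheck = true) :
    T.faces.card = T.crossings.card + n + 1 := by
  obtain ⟨cs, h1, hne, hcyc, hcover, -⟩ :=
    T.collect_spec _ _ [] _ (by simp) (by simp) h
  simp only [Bool.and_eq_true, beq_iff_eq] at h1
  rw [← h1.2]
  refine T.card_faces_of_cycles cs hne hcyc (fun d hd => hcover d ?_) h1.1
  simp only [darts, Finset.mem_filter, Finset.mem_product, List.mem_toFinset, Finset.mem_univ,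
    and_true] at hd
  simp only [dartList, List.mem_flatMap]
  refine ⟨d.1, hd.1, List.mem_filter.2 ⟨?_, by simpa using hd.2⟩⟩
  rcases d with ⟨a, _ | _⟩ <;> simp

/-- A test for `IsDiagram`. -/
def diagramCheck (T : TangleCode n) : Bool :=
  decide T.passages.Nodup && decide (∀ p ∈ T.passages, p.other ∈ T.passages) &&
  decide (∀ p ∈ T.passages, ∀ q ∈ T.passages, p.crossing = q.crossing → p.positive = q.positive) &&
  decide T.boundary.Nodup && decide (∀ e : Fin n × Bool, e ∈ T.boundary) && T.planarCheck

theorem isDiagram_of_diagramCheck (T : TangleCode n) (h : T.diagramCheck = true) :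
    T.IsDiagram := by
  simp only [diagramCheck, Bool.and_eq_true, decide_eq_true_eq] at h
  obtain ⟨⟨⟨⟨⟨h1, h2⟩, h3⟩, h4⟩, h5⟩, h6⟩ := h
  exact ⟨h1, h2, h3, h4, h5, T.planar_of_planarCheck h6⟩

end TangleCode

/-! ### Sequences of moves given by instructions -/

/-- The tangle code with the given strands. -/
def codeOf {n : ℕ} (b : List (Fin n × Bool)) (W : List (List Passage)) : TangleCode n where
  strand i := W.getD i []
  boundary := b

/-- The four moves that the generating set below consists of. -/
def basicMoves : Finset Move := {.Ω1a, .Ω1b, .Ω2a, .Ω3a}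

/-- An instruction for a move in `basicMoves`.
* `loop i k c o` inserts a loop with positive crossing `c` before entry `k` of strand `i`, which
  first passes over itself if `o = true`; `unloop c o` is its inverse.
* `bigon i k j l c d` inserts two passages over `c`, `d` in strand `i` before entry `k`, then the
  passages under `c`, `d` in strand `j` before entry `l`; `unbigon c d` is its inverse.
* `triangle p q r f` inverts a triangle. -/
inductive Instruction where
  | loop (i k c : ℕ) (o : Bool)
  | unloop (c : ℕ) (o : Bool)
  | bigon (i k j l c d : ℕ)
  | unbigon (c d : ℕ)
  | triangle (p q r : Passage) (f : Bool)

/-- Insert passages before entry `k` of strand `i`. -/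
def insertPassages (W : List (List Passage)) (i k : ℕ) (l : List Passage) : List (List Passage) :=
  W.modify i fun w => w.take k ++ l ++ w.drop k

/-- Remove crossings from all strands. -/
def eraseCrossings (W : List (List Passage)) (s : List ℕ) : List (List Passage) :=
  W.map (List.filter fun p => p.crossing ∉ s)

/-- Permute the passages on all strands. -/
def permutePassages (W : List (List Passage)) (σ : Equiv.Perm Passage) : List (List Passage) :=
  W.map (List.map σ)

theorem codeOf_eraseCrossings {n : ℕ} (b : List (Fin n × Bool)) (W : List (List Passage))
    (s : List ℕ) : codeOf b (eraseCrossings W s) = (codeOf b W).erase s := by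
  ext1
  · funext i
    simp only [codeOf, eraseCrossings, TangleCode.erase, List.getD_eq_getElem?_getD,
      List.getElem?_map]
    cases W[(i : ℕ)]? <;> simp
  · rfl

theorem codeOf_permutePassages {n : ℕ} (b : List (Fin n × Bool)) (W : List (List Passage))
    (σ : Equiv.Perm Passage) : codeOf b (permutePassages W σ) = (codeOf b W).permute σ := by
  ext1
  · funext i
    simp only [codeOf, permutePassages, TangleCode.permute, List.getD_eq_getElem?_getD,
      List.getElem?_map]
    cases W[(i : ℕ)]? <;> simp
  · rfl

theorem codeOf_ofFn {n : ℕ} (T : TangleCode n) : codeOf T.boundary (List.ofFn T.strand) = T := by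
  ext1
  · funext i
    simp [codeOf]
  · rfl

/-- The permutation of the passages in a move of type 3. -/
def trianglePerm (p q r : Passage) : Equiv.Perm Passage :=
  Equiv.swap p q.other * (Equiv.swap q r.other * Equiv.swap r p.other)

namespace Instruction

/-- The result of an instruction. -/
def apply (W : List (List Passage)) : Instruction → List (List Passage)
  | loop i k c o => insertPassages W i k [⟨c, o, true⟩, ⟨c, !o, true⟩]
  | unloop c _ => eraseCrossings W [c]
  | bigon i k j l c d => insertPassages (insertPassages W i k [ov c true, ov d false]) j l
      [un c true, un d false]
  | unbigon c d => eraseCrossings W [c, d]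
  | triangle p q r _ => permutePassages W (trianglePerm p q r)

/-- A test that an instruction leading from `W` to `W'` is a move. -/
def check {n : ℕ} (b : List (Fin n × Bool)) (W W' : List (List Passage)) : Instruction → Bool
  | loop _ _ c o => decide ((codeOf b W').HasFace [(un c true, !o)]) &&
      decide (eraseCrossings W' [c] = W)
  | unloop c o => decide ((codeOf b W).HasFace [(un c true, !o)])
  | bigon _ _ _ _ c d => decide ((codeOf b W').HasFace [(ov c true, true), (un d false, false)]) &&
      decide (eraseCrossings W' [c, d] = W)
  | unbigon c d => decide ((codeOf b W).HasFace [(ov c true, true), (un d false, false)])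
  | triangle p q r f => decide ((codeOf b W).HasFace [(p, f), (q, f), (r, f)]) &&
      (p.isOver && !q.isOver && [p, q, r].countP Passage.positive == 2)

/-- Carry out instructions, starting from `W`, with a test of each of them, then apply `k`. -/
def run {n : ℕ} (b : List (Fin n × Bool)) (k : List (List Passage) → Bool) :
    List (List Passage) → List Instruction → Bool
  | W, [] => k W
  | W, x :: xs => forceList (forceList Passage.force) (x.apply W) fun W' =>
      (x.check b W W' && (codeOf b W').diagramCheck) && run b k W' xs

end Instruction

/-- The permutation that interchanges the given pairs in turn. -/
def permOfSwaps : List (ℕ × ℕ) → Equiv.Perm ℕ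
  | [] => 1
  | x :: l => Equiv.swap x.1 x.2 * permOfSwaps l

/-- A test that instructions lead from the source of `m` to its target, up to renaming. -/
def Move.check (m : Move) (xs : List Instruction) (l : List (ℕ × ℕ)) : Bool :=
  forceList (forceList Passage.force) (List.ofFn m.source.strand) fun W =>
    Instruction.run m.source.boundary (fun W' => decide (∀ i, m.target.strand i =
      ((codeOf m.source.boundary W').strand i).map (Passage.rename (permOfSwaps l)))) W xs

/-! ### Soundness of the instructions -/

section Soundness

variable {n : ℕ}

/-- Two diagrams are connected by isotopies and basic moves. -/
def BasicEquiv (D D' : {T : TangleCode n // T.IsDiagram}) : Prop :=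
  Relation.EqvGen (fun D D' : {T : TangleCode n // T.IsDiagram} =>
    TangleCode.Isotopic D.1 D'.1 ∨ ∃ k ∈ basicMoves, k.Step D.1 D'.1) D D'

/-- For types 1 and 2 `Step` only removes crossings, so an insertion is verified backwards: the new
diagram has the required face, and erasing the new crossings gives back the old one. -/
theorem Instruction.step_of_check (b : List (Fin n × Bool)) (W : List (List Passage))
    (x : Instruction) (h : x.check b W (x.apply W) = true) : ∃ k ∈ basicMoves,
      k.Step (codeOf b W) (codeOf b (x.apply W)) ∨ k.Step (codeOf b (x.apply W)) (codeOf b W) := by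
  cases x with
  | loop i k c o =>
    simp only [check, Bool.and_eq_true, decide_eq_true_eq] at h
    refine ⟨bif o then .Ω1a else .Ω1b, by cases o <;> simp [basicMoves], .inr (.inl
      ⟨_, _, h.1, by cases o <;> simp [Move.OfMonogon], ?_⟩)⟩
    rw [← codeOf_eraseCrossings, h.2]
  | unloop c o =>
    simp only [check, decide_eq_true_eq] at h
    exact ⟨bif o then .Ω1a else .Ω1b, by cases o <;> simp [basicMoves], .inl (.inl
      ⟨_, _, h, by cases o <;> simp [Move.OfMonogon], codeOf_eraseCrossings _ _ _⟩)⟩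
  | bigon i k j l c d =>
    simp only [check, Bool.and_eq_true, decide_eq_true_eq] at h
    refine ⟨.Ω2a, by simp [basicMoves], .inr (.inr (.inl
      ⟨_, _, _, _, h.1, by simp, by simp [Move.OfBigon], ?_⟩))⟩
    rw [← codeOf_eraseCrossings, h.2]
  | unbigon c d =>
    simp only [check, decide_eq_true_eq] at h
    exact ⟨.Ω2a, by simp [basicMoves], .inl (.inr (.inl
      ⟨_, _, _, _, h, by simp, by simp [Move.OfBigon], codeOf_eraseCrossings _ _ _⟩))⟩
  | triangle p q r f =>
    simp only [check, Bool.and_eq_true, decide_eq_true_eq, Bool.not_eq_true', beq_iff_eq] at h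
    exact ⟨.Ω3a, by simp [basicMoves], .inl (.inr (.inr
      ⟨p, q, r, f, f, f, h.1, h.2.1.1, h.2.1.2, ⟨⟨rfl, rfl⟩, h.2.2⟩,
        codeOf_permutePassages _ _ _⟩))⟩

/-- The equivalence relation lives on planar diagrams, which is why `run` tests every intermediate
code as well as every move. -/
theorem Instruction.equiv_of_run (b : List (Fin n × Bool)) (k : List (List Passage) → Bool)
    (W : List (List Passage)) (hW : (codeOf b W).IsDiagram) (xs : List Instruction)
    (h : run b k W xs = true) : ∃ (W' : List (List Passage)) (hW' : (codeOf b W').IsDiagram),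
      k W' = true ∧ BasicEquiv ⟨codeOf b W, hW⟩ ⟨codeOf b W', hW'⟩ := by
  induction xs generalizing W with
  | nil => exact ⟨W, hW, h, .refl _⟩
  | cons x xs ih =>
    simp only [run, forceList_eq (forceList_eq Passage.force_eq), Bool.and_eq_true] at h
    obtain ⟨⟨h1, h2⟩, h3⟩ := h
    have h2 := TangleCode.isDiagram_of_diagramCheck _ h2
    obtain ⟨W', hW', hk, he⟩ := ih _ h2 h3
    refine ⟨W', hW', hk, .trans _ _ _ ?_ he⟩
    obtain ⟨m, hm, hs | hs⟩ := step_of_check b W x h1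
    · exact .rel _ _ (.inr ⟨m, hm, hs⟩)
    · exact .symm _ _ (.rel _ _ (.inr ⟨m, hm, hs⟩))

theorem Move.realizedBy_of_check (m : Move) (xs : List Instruction) (l : List (ℕ × ℕ))
    (h : m.check xs l = true) : m.RealizedBy basicMoves := by
  simp only [check, forceList_eq (forceList_eq Passage.force_eq)] at h
  have h0 := codeOf_ofFn m.source
  obtain ⟨W, hW, hk, he⟩ := Instruction.equiv_of_run _ _ _ (h0.symm ▸ m.source_isDiagram) _ h
  have h1 : BasicEquiv ⟨m.source, m.source_isDiagram⟩ ⟨codeOf m.source.boundary W, hW⟩ := by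
    convert he
    exact h0.symm
  refine .trans _ _ _ h1 (.rel _ _ (.inl ⟨rfl, permOfSwaps l, ?_⟩))
  simpa using hk

end Soundness

theorem Move.realizedBy_of_mem {m : Move} {S : Finset Move} (h : m ∈ S) : m.RealizedBy S :=
  .rel _ _ (.inr ⟨m, h, m.step_source_target⟩)

/-! ### Deriving the other twelve moves from Ω1a, Ω1b, Ω2a, Ω3a -/

section Derivations

open Instruction

/-- Two positive curls are put inside the negative loop. After Ω3a the negative crossing cancels
with one of the positive crossings by Ω2a, and the other is a removable loop. -/
theorem realizedBy_Ω1c : Move.Ω1c.RealizedBy basicMoves :=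
  Move.realizedBy_of_check _ [
    .loop 0 1 1 false, .loop 0 1 2 false, .triangle (ov 0 false) (un 1 true) (un 2 true) false,
    .unbigon 2 0, .unloop 1 false]
    [] (by decide +kernel)

theorem realizedBy_Ω1d : Move.Ω1d.RealizedBy basicMoves :=
  Move.realizedBy_of_check _ [
    .loop 0 1 1 true, .loop 0 1 2 true, .triangle (ov 0 false) (un 2 true) (un 1 true) true,
    .unbigon 2 0, .unloop 1 true]
    [] (by decide +kernel)

/-- The first four instructions create an antiparallel bigon of strand 1 with itself. Sliding strand
0 across its positive crossing 3, which then becomes a removable loop, turns the given parallel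
bigon into one of type Ω2d. That bigon is removed by the Ω2d sequence, and the remaining negative
curl by the Ω1c sequence. -/
theorem realizedBy_Ω2b : Move.Ω2b.RealizedBy basicMoves :=
  Move.realizedBy_of_check _ [
    .loop 1 2 2 false, .bigon 1 3 1 0 3 4, .triangle (ov 4 false) (un 2 true) (un 3 true) true,
    .unloop 2 false, .triangle (ov 0 false) (un 1 true) (un 3 true) true, .unloop 3 false,
    .loop 0 1 2 false, .triangle (ov 0 false) (un 2 true) (un 1 true) false, .unbigon 1 0,
    .unloop 2 false, .loop 1 1 0 false, .loop 1 1 1 false,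
    .triangle (ov 4 false) (un 0 true) (un 1 true) false, .unbigon 1 4, .unloop 0 false]
    [] (by decide +kernel)

/-- A curl on the under-edge makes a well-oriented triangle with the two given crossings; after Ω3a
these bound a parallel bigon, and Ω2a applies. -/
theorem realizedBy_Ω2c : Move.Ω2c.RealizedBy basicMoves :=
  Move.realizedBy_of_check _ [
    .loop 1 1 2 true, .triangle (ov 0 false) (un 1 true) (un 2 true) true, .unbigon 1 0,
    .unloop 2 true]
    [] (by decide +kernel)

theorem realizedBy_Ω2d : Move.Ω2d.RealizedBy basicMoves :=
  Move.realizedBy_of_check _ [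
    .loop 0 1 2 false, .triangle (ov 1 false) (un 2 true) (un 0 true) false, .unbigon 0 1,
    .unloop 2 false]
    [] (by decide +kernel)

/-- An antiparallel bigon 4, 5 is created so that its negative crossing 5 forms a well-oriented
triangle with 0 and 2. After Ω3a, crossing 5 cancels with the old crossing 1 in another antiparallel
bigon, and 4 survives in the role of 1; hence the renaming. -/
theorem realizedBy_Ω3b : Move.Ω3b.RealizedBy basicMoves :=
  Move.realizedBy_of_check _ [
    .loop 0 0 3 false, .bigon 0 1 2 2 4 5, .triangle (ov 5 false) (un 3 true) (un 4 true) true,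
    .unloop 3 false, .triangle (ov 5 false) (un 0 true) (un 2 true) true, .loop 2 1 3 true,
    .triangle (ov 5 false) (un 1 true) (un 3 true) true, .unbigon 1 5, .unloop 3 true]
    [(1, 4)] (by decide +kernel)

theorem realizedBy_Ω3c : Move.Ω3c.RealizedBy basicMoves :=
  Move.realizedBy_of_check _ [
    .loop 0 2 3 false, .bigon 0 3 1 0 4 5, .triangle (ov 5 false) (un 3 true) (un 4 true) true,
    .unloop 3 false, .triangle (ov 1 false) (un 4 true) (un 2 true) true, .loop 1 3 3 true,
    .triangle (ov 0 false) (un 4 true) (un 3 true) true, .unbigon 4 0, .unloop 3 true]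
    [(0, 5)] (by decide +kernel)

/-- A parallel bigon 3, 4 provides a negative crossing 4, so that 0, 4, 2 bound a triangle with one
positive crossing. This triangle is inverted by the create, slide and cancel pattern of Ω3b. The
last fifteen instructions remove the bigon of 4 and 1 as in Ω2b. -/
theorem realizedBy_Ω3d : Move.Ω3d.RealizedBy basicMoves :=
  Move.realizedBy_of_check _ [
    .bigon 0 0 2 0 3 4, .loop 1 2 5 false, .bigon 1 3 2 1 6 7,
    .triangle (ov 7 false) (un 5 true) (un 6 true) true, .unloop 5 false,
    .triangle (ov 4 false) (un 0 true) (un 6 true) true, .loop 2 4 5 true,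
    .triangle (ov 2 false) (un 6 true) (un 5 true) true, .unbigon 6 2, .unloop 5 true,
    .loop 2 4 2 false, .bigon 2 5 2 2 5 6, .triangle (ov 6 false) (un 2 true) (un 5 true) true,
    .unloop 2 false, .triangle (ov 4 false) (un 1 true) (un 5 true) true, .unloop 5 false,
    .loop 0 3 2 false, .triangle (ov 4 false) (un 2 true) (un 1 true) false, .unbigon 1 4,
    .unloop 2 false, .loop 2 3 1 false, .loop 2 3 2 false,
    .triangle (ov 6 false) (un 1 true) (un 2 true) false, .unbigon 2 6, .unloop 1 false]
    [(2, 7), (1, 3)] (by decide +kernel)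

theorem realizedBy_Ω3e : Move.Ω3e.RealizedBy basicMoves :=
  Move.realizedBy_of_check _ [
    .bigon 0 2 1 2 3 4, .loop 2 0 5 true, .bigon 0 3 2 1 6 7,
    .triangle (ov 7 false) (un 6 true) (un 5 true) false, .unloop 5 true,
    .triangle (ov 7 false) (un 3 true) (un 2 true) false, .loop 0 2 5 false,
    .triangle (ov 7 false) (un 5 true) (un 1 true) false, .unbigon 1 7, .unloop 5 false,
    .loop 1 2 1 false, .bigon 1 3 1 0 5 7, .triangle (ov 7 false) (un 1 true) (un 5 true) true,
    .unloop 1 false, .triangle (ov 0 false) (un 3 true) (un 5 true) true, .unloop 5 false,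
    .loop 0 1 1 false, .triangle (ov 0 false) (un 1 true) (un 3 true) false, .unbigon 3 0,
    .unloop 1 false, .loop 1 1 0 false, .loop 1 1 1 false,
    .triangle (ov 7 false) (un 0 true) (un 1 true) false, .unbigon 1 7, .unloop 0 false]
    [(1, 6), (0, 4)] (by decide +kernel)

theorem realizedBy_Ω3f : Move.Ω3f.RealizedBy basicMoves :=
  Move.realizedBy_of_check _ [
    .loop 2 2 3 true, .bigon 1 0 2 3 4 5, .triangle (ov 5 false) (un 4 true) (un 3 true) false,
    .unloop 3 true, .triangle (ov 1 false) (un 0 true) (un 4 true) false, .loop 1 3 3 false,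
    .triangle (ov 2 false) (un 3 true) (un 4 true) false, .unbigon 4 2, .unloop 3 false]
    [(2, 5)] (by decide +kernel)

theorem realizedBy_Ω3g : Move.Ω3g.RealizedBy basicMoves :=
  Move.realizedBy_of_check _ [
    .bigon 0 2 1 2 3 4, .loop 1 3 5 false, .bigon 1 4 2 0 6 7,
    .triangle (ov 7 false) (un 5 true) (un 6 true) true, .unloop 5 false,
    .triangle (ov 1 false) (un 3 true) (un 6 true) true, .loop 2 3 5 true,
    .triangle (ov 2 false) (un 6 true) (un 5 true) true, .unbigon 6 2, .unloop 5 true,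
    .loop 1 2 2 false, .bigon 1 3 1 0 5 6, .triangle (ov 6 false) (un 2 true) (un 5 true) true,
    .unloop 2 false, .triangle (ov 0 false) (un 3 true) (un 5 true) true, .unloop 5 false,
    .loop 0 1 2 false, .triangle (ov 0 false) (un 2 true) (un 3 true) false, .unbigon 3 0,
    .unloop 2 false, .loop 1 1 0 false, .loop 1 1 2 false,
    .triangle (ov 6 false) (un 0 true) (un 2 true) false, .unbigon 2 6, .unloop 0 false]
    [(2, 7), (0, 4)] (by decide +kernel)

theorem realizedBy_Ω3h : Move.Ω3h.RealizedBy basicMoves :=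
  Move.realizedBy_of_check _ [
    .loop 1 2 3 false, .bigon 1 3 2 0 4 5, .triangle (ov 5 false) (un 3 true) (un 4 true) true,
    .unloop 3 false, .bigon 0 2 1 3 3 6, .loop 2 1 7 true, .bigon 0 3 2 2 8 9,
    .triangle (ov 9 false) (un 8 true) (un 7 true) false, .unloop 7 true,
    .triangle (ov 9 false) (un 3 true) (un 4 true) false, .loop 0 2 7 false,
    .triangle (ov 9 false) (un 7 true) (un 1 true) false, .unbigon 1 9, .unloop 7 false,
    .loop 1 3 1 false, .bigon 1 4 1 1 7 9, .triangle (ov 9 false) (un 1 true) (un 7 true) true,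
    .unloop 1 false, .triangle (ov 0 false) (un 3 true) (un 7 true) true, .unloop 7 false,
    .loop 0 1 1 false, .triangle (ov 0 false) (un 1 true) (un 3 true) false, .unbigon 3 0,
    .unloop 1 false, .loop 1 2 0 false, .loop 1 2 1 false,
    .triangle (ov 9 false) (un 0 true) (un 1 true) false, .unbigon 1 9, .unloop 0 false,
    .loop 2 3 0 true, .triangle (ov 2 false) (un 4 true) (un 0 true) true, .unbigon 4 2,
    .unloop 0 true]
    [(1, 0), (0, 2), (2, 8), (1, 6), (0, 5)] (by decide +kernel)

end Derivations

theorem isGenerating_basicMoves : IsGenerating basicMoves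
  | .Ω1a => Move.realizedBy_of_mem (by decide)
  | .Ω1b => Move.realizedBy_of_mem (by decide)
  | .Ω1c => realizedBy_Ω1c
  | .Ω1d => realizedBy_Ω1d
  | .Ω2a => Move.realizedBy_of_mem (by decide)
  | .Ω2b => realizedBy_Ω2b
  | .Ω2c => realizedBy_Ω2c
  | .Ω2d => realizedBy_Ω2d
  | .Ω3a => Move.realizedBy_of_mem (by decide)
  | .Ω3b => realizedBy_Ω3b
  | .Ω3c => realizedBy_Ω3c
  | .Ω3d => realizedBy_Ω3d
  | .Ω3e => realizedBy_Ω3e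
  | .Ω3f => realizedBy_Ω3f
  | .Ω3g => realizedBy_Ω3g
  | .Ω3h => realizedBy_Ω3h

/-! ### The passages next to a face -/

theorem Passage.other_other (p : Passage) : p.other.other = p := by
  cases p; simp [Passage.other]

theorem Passage.other_ne (p : Passage) : p.other ≠ p := by
  cases p; simp [Passage.other]

namespace TangleCode

variable {n : ℕ}

/-- The passage `y` follows `x` immediately on a strand. -/
def Consec (T : TangleCode n) (x y : Passage) : Prop :=
  ∃ i u v, T.strand i = u ++ x :: y :: v

theorem mem_passages {T : TangleCode n} {p : Passage} :
    p ∈ T.passages ↔ ∃ i, p ∈ T.strand i := by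
  simp [passages]

theorem strand_nodup {T : TangleCode n} (h : T.passages.Nodup) (i : Fin n) :
    (T.strand i).Nodup :=
  (List.nodup_flatMap.1 h).1 i (List.mem_finRange i)

theorem eq_of_mem_strand {T : TangleCode n} (h : T.passages.Nodup) {p : Passage} {i j : Fin n}
    (hi : p ∈ T.strand i) (hj : p ∈ T.strand j) : i = j := by
  by_contra hij
  have h2 : (List.finRange n).Pairwise (Function.onFun List.Disjoint T.strand) :=
    (List.nodup_flatMap.1 h).2
  have : Std.Symm (Function.onFun List.Disjoint T.strand) := ⟨fun _ _ hab => hab.symm⟩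
  exact h2.forall (List.mem_finRange i) (List.mem_finRange j) hij hi hj

/-- The list of nodes, split at a passage. -/
theorem nodes_eq {T : TangleCode n} (h : T.passages.Nodup) {p : Passage} {i : Fin n}
    {u w : List Passage} (hi : T.strand i = u ++ p :: w) :
    ∃ A B, T.nodes = (A ++ .endpoint i false :: u.map .passage) ++
        .passage p :: ((w.map .passage ++ [.endpoint i true]) ++ B) ∧
      Node.passage p ∉ A ++ Node.endpoint i false :: u.map Node.passage := by
  obtain ⟨a, b, hab⟩ := List.append_of_mem (List.mem_finRange i)
  have hnd := List.nodup_finRange n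
  refine ⟨a.flatMap fun i => Node.endpoint i false ::
      ((T.strand i).map Node.passage ++ [Node.endpoint i true]),
    b.flatMap fun i => Node.endpoint i false ::
      ((T.strand i).map Node.passage ++ [Node.endpoint i true]), ?_, ?_⟩
  · simp [nodes, hab, hi]
  · have hs := strand_nodup h i
    rw [hi] at hs
    simp only [List.mem_append, List.mem_flatMap, List.mem_cons, List.mem_map, Node.passage.injEq,
      exists_eq_right, List.not_mem_nil, or_false, reduceCtorEq, false_or, not_or, not_exists,
      not_and]
    refine ⟨fun j hj hpj => ?_, fun hu => ?_⟩
    · have : j = i := eq_of_mem_strand h hpj (by simp [hi])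
      subst this
      rw [hab] at hnd
      exact (List.nodup_append.1 hnd).2.2 _ hj _ (by simp) rfl
    · exact (List.nodup_append.1 hs).2.2 _ hu _ (by simp) rfl

theorem consec_of_next {T : TangleCode n} (h : T.passages.Nodup) {p q : Passage}
    (hp : p ∈ T.passages) (hq : T.next (.passage p) = .passage q) : T.Consec p q := by
  obtain ⟨i, hi⟩ := mem_passages.1 hp
  obtain ⟨u, w, hi⟩ := List.append_of_mem hi
  obtain ⟨A, B, hn, hA⟩ := nodes_eq h hi
  refine ⟨i, u, ?_⟩
  rw [next, hn, List.idxOf_append_of_notMem hA, List.idxOf_cons_self,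
    List.getD_append_right _ _ _ _ (by omega)] at hq
  -- If `p` is the last passage of its strand, the next node is an end point, which contradicts
  -- `hq`.
  rcases w with _ | ⟨x, w⟩
  · simp at hq
  · simp only [List.map_cons, List.cons_append, add_zero, Nat.add_sub_cancel_left,
      List.getD_cons_succ, List.getD_cons_zero, Node.passage.injEq] at hq
    exact ⟨w, by rw [hi, hq]⟩

theorem consec_of_prev {T : TangleCode n} (h : T.passages.Nodup) {p q : Passage}
    (hp : p ∈ T.passages) (hq : T.prev (.passage p) = .passage q) : T.Consec q p := by
  obtain ⟨i, hi⟩ := mem_passages.1 hp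
  obtain ⟨u, w, hi⟩ := List.append_of_mem hi
  obtain ⟨A, B, hn, hA⟩ := nodes_eq h hi
  refine ⟨i, ?_⟩
  -- The nodes before `p` include the initial end point, so subtracting one from the index does not
  -- truncate.
  rw [prev, hn, List.idxOf_append_of_notMem hA, List.idxOf_cons_self, add_zero,
    List.getD_append _ _ _ _ (by simp)] at hq
  rcases List.eq_nil_or_concat u with rfl | ⟨u, x, rfl⟩
  · simp at hq
  · have : (A ++ Node.endpoint i false :: (u ++ [x]).map Node.passage) =
      (A ++ Node.endpoint i false :: u.map Node.passage) ++ [Node.passage x] := by simp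
    rw [List.concat_eq_append, this, List.length_append, List.length_singleton, Nat.add_sub_cancel,
      List.getD_append_right _ _ _ _ le_rfl, Nat.sub_self, List.getD_cons_zero,
      Node.passage.injEq] at hq
    exact ⟨u, w, by rw [hi, ← hq]; simp⟩

/-- An edge of a face, between two crossings. -/
theorem consec_of_faceNext {T : TangleCode n} (h : T.passages.Nodup) {p q : Passage} {f g : Bool}
    (hp : p ∈ T.passages) (hq : T.faceNext (.passage p, f) = (.passage q, g)) :
    (if f then T.Consec p q.other else T.Consec q.other p) ∧ g = (f == q.other.fromRight) := by
  unfold faceNext at hq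
  split at hq
  · next x hx =>
    simp only [Prod.mk.injEq, Node.passage.injEq] at hq
    obtain ⟨rfl, rfl⟩ := hq
    rw [Passage.other_other]
    refine ⟨?_, rfl⟩
    cases f
    · simpa using consec_of_prev h hp (by simpa using hx)
    · simpa using consec_of_next h hp (by simpa using hx)
  · simp at hq

end TangleCode

theorem Passage.other_injective : Function.Injective Passage.other :=
  Function.LeftInverse.injective Passage.other_other

namespace TangleCode

variable {n : ℕ}

theorem Consec.mem_left {T : TangleCode n} {x y : Passage} (h : T.Consec x y) :
    x ∈ T.passages := by
  obtain ⟨i, u, v, hi⟩ := h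
  exact mem_passages.2 ⟨i, by simp [hi]⟩

theorem Consec.mem_right {T : TangleCode n} {x y : Passage} (h : T.Consec x y) :
    y ∈ T.passages := by
  obtain ⟨i, u, v, hi⟩ := h
  exact mem_passages.2 ⟨i, by simp [hi]⟩

theorem Consec.mem_strand_iff {T : TangleCode n} (hT : T.passages.Nodup) {x y : Passage}
    (h : T.Consec x y) (j : Fin n) : x ∈ T.strand j ↔ y ∈ T.strand j := by
  obtain ⟨i, u, v, hi⟩ := h
  have hx : x ∈ T.strand i := by simp [hi]
  have hy : y ∈ T.strand i := by simp [hi]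
  constructor
  · intro h
    rwa [eq_of_mem_strand hT h hx]
  · intro h
    rwa [eq_of_mem_strand hT h hy]

/-- Two passages of the same crossing are equal or belong to the two strands through it. -/
theorem IsDiagram.eq_or_eq_other {T : TangleCode n} (hT : T.IsDiagram) {p q : Passage}
    (hp : p ∈ T.passages) (hq : q ∈ T.passages) (h : p.crossing = q.crossing) :
    p = q ∨ p = q.other := by
  have h2 := hT.sign_eq p hp q hq h
  rcases p with ⟨c, _ | _, s⟩ <;> rcases q with ⟨d, _ | _, t⟩ <;> simp_all [Passage.other]

theorem erase_congr {T : TangleCode n} {s t : List ℕ} (h : ∀ c, c ∈ s ↔ c ∈ t) :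
    T.erase s = T.erase t := by
  simp [erase, h]

/-- `T'` arises from `T` by interchanging the consecutive passages `x`, `y`. -/
def Interchange (T T' : TangleCode n) (x y : Passage) : Prop :=
  x.crossing ≠ y.crossing ∧ ∃ i u v, T.strand i = u ++ x :: y :: v ∧
    T'.strand i = u ++ y :: x :: v ∧ ∀ j ≠ i, T'.strand j = T.strand j

theorem permute_nodup {T : TangleCode n} (hT : T.passages.Nodup) (σ : Equiv.Perm Passage) :
    (T.permute σ).passages.Nodup := by
  have : (T.permute σ).passages = T.passages.map σ := by
    simp [passages, permute, List.map_flatMap]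
  rw [this]
  exact hT.map σ.injective

theorem Consec.permute {T : TangleCode n} {x y : Passage} (h : T.Consec x y)
    (σ : Equiv.Perm Passage) : (T.permute σ).Consec (σ x) (σ y) := by
  obtain ⟨i, u, v, hi⟩ := h
  exact ⟨i, u.map σ, v.map σ, by simp [TangleCode.permute, hi]⟩

theorem permute_mul (T : TangleCode n) (σ τ : Equiv.Perm Passage) :
    T.permute (σ * τ) = (T.permute τ).permute σ := by
  simp [permute]

/-- Since no passage occurs twice, the transposition moves nothing besides this adjacent pair. -/
theorem interchange_permute {T : TangleCode n} (hT : T.passages.Nodup) {x y : Passage}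
    (h : T.Consec x y) (hc : x.crossing ≠ y.crossing) :
    T.Interchange (T.permute (Equiv.swap x y)) x y := by
  obtain ⟨i, u, v, hi⟩ := h
  have hx : x ∈ T.strand i := by simp [hi]
  have hy : y ∈ T.strand i := by simp [hi]
  have hnd := strand_nodup hT i
  rw [hi] at hnd
  have hfix : ∀ l : List Passage, x ∉ l → y ∉ l → l.map (Equiv.swap x y) = l := by
    intro l hx hy
    conv_rhs => rw [← List.map_id l]
    refine List.map_congr_left fun z hz => Equiv.swap_apply_of_ne_of_ne ?_ ?_
    · rintro rfl; exact hx hz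
    · rintro rfl; exact hy hz
  simp only [List.nodup_append, List.nodup_cons, List.mem_cons, not_or] at hnd
  obtain ⟨-, ⟨⟨-, hxv⟩, hyv, -⟩, hd⟩ := hnd
  refine ⟨hc, i, u, v, hi, ?_, fun j hj => ?_⟩
  · have h1 := hfix u (fun h => hd _ h _ (.inl rfl) rfl) fun h => hd _ h _ (.inr (.inl rfl)) rfl
    have h2 := hfix v hxv hyv
    simp [permute, hi, h1, h2]
  · exact hfix _ (fun h => hj (eq_of_mem_strand hT h hx)) fun h => hj (eq_of_mem_strand hT h hy)

end TangleCode

/-! ### The moves on the strands -/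

namespace Move

/-- For a move of type 1, whether the loop first passes over itself. -/
def loopOver : Move → Bool
  | Ω1a | Ω1d => true
  | _ => false

/-- For a move of type 2, whether the first crossing on the over-strand (`o = true`) or on the
under-strand (`o = false`) is positive. -/
def bigonSign (o : Bool) : Move → Bool
  | Ω2a => true
  | Ω2c => !o
  | Ω2d => o
  | _ => false

/-- For a move of type 3, the two crossings on the top strand (`o = true`) or on the bottom strand
(`o = false`) have the same sign. -/
def SameSign (o : Bool) : Move → Prop
  | Ω3b | Ω3g => True
  | Ω3c | Ω3d => o = true
  | Ω3e | Ω3f => o = false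
  | _ => False

variable {n : ℕ} {k : Move} {T T' : TangleCode n}

theorem strands_of_ofMonogon {p : Passage} {f : Bool} (h : k.OfMonogon p f) : k.strands = 1 := by
  cases k <;> simp_all [OfMonogon, strands]

theorem strands_of_ofBigon {p : Passage} {f g : Bool} (h : k.OfBigon p f g) : k.strands = 2 := by
  cases k <;> simp_all [OfBigon, strands]

theorem strands_of_ofTriangle {p q r : Passage} {f g h : Bool} (H : OfTriangle p q r f g h k) :
    k.strands = 3 := by
  cases k <;> simp_all [OfTriangle, strands]

/-- The hypothesis `h` is the left-turn rule of `faceNext` at the end of the single edge. Together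
with the sign and the orientation of the loop it decides which passage comes first. -/
theorem loopOver_eq {p : Passage} {f : Bool} (hk : k.OfMonogon p f)
    (h : f = (f == p.other.fromRight)) : k.loopOver = if f then p.isOver else !p.isOver := by
  rcases p with ⟨c, _ | _, _ | _⟩ <;> cases f <;> cases k <;>
    simp [Passage.other, Passage.fromRight, OfMonogon, loopOver] at *

/-- The hypotheses on `f` and `g` are the left-turn rules at the two corners. They force opposite
signs and, once the move is known, the order of the signs along each edge. -/
theorem bigonSign_eq {p q : Passage} {f g : Bool} (hk : k.OfBigon p f g)
    (hpq : p.isOver = !q.isOver) (hg : g = (f == q.other.fromRight))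
    (hf : f = (g == p.other.fromRight)) :
    (if f then p.positive else q.positive) = k.bigonSign p.isOver ∧
      (if g then q.positive else p.positive) = k.bigonSign q.isOver ∧
        p.positive = !q.positive := by
  rcases p with ⟨c, _ | _, _ | _⟩ <;> rcases q with ⟨d, _ | _, _ | _⟩ <;> cases f <;> cases g <;>
    cases k <;> revert hk hpq hg hf <;>
    simp [Passage.other, Passage.fromRight, OfBigon, bigonSign]

theorem bigon_edge {p q : Passage} {f g s : Bool} (hpq : p.isOver = !q.isOver)
    (h1 : if f then T.Consec p q.other else T.Consec q.other p)
    (h2 : if g then T.Consec q p.other else T.Consec p.other q)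
    (hs : (if f then p.positive else q.positive) = s) (hpos : p.positive = !q.positive) :
    ∃ x y, x.isOver = p.isOver ∧ y.isOver = p.isOver ∧ T.Consec x y ∧
      (T.Consec x.other y.other ∨ T.Consec y.other x.other) ∧ x.positive = s ∧
      (y.positive = !s) ∧ T.erase [p.crossing, q.crossing] = T.erase [x.crossing, y.crossing] := by
  cases f
  · refine ⟨q.other, p, hpq.symm, rfl, by simpa using h1, ?_, hs, ?_,
      TangleCode.erase_congr fun c => by simp [Passage.other, or_comm]⟩
    · rw [Passage.other_other]
      cases g
      · exact .inr (by simpa using h2)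
      · exact .inl (by simpa using h2)
    · rw [hpos, ← hs]; rfl
  · refine ⟨p, q.other, rfl, hpq.symm, by simpa using h1, ?_, hs, ?_, rfl⟩
    · rw [Passage.other_other]
      cases g
      · exact .inl (by simpa using h2)
      · exact .inr (by simpa using h2)
    · rw [← hs, if_pos rfl, hpos, Bool.not_not]; rfl

theorem loop_spec (hT : T.IsDiagram) {p : Passage} {f : Bool} (hf : T.HasFace [(p, f)])
    (hk : k.OfMonogon p f) :
    ∃ x, T.Consec x x.other ∧ x.isOver = k.loopOver ∧ x.crossing = p.crossing := by
  obtain ⟨-, hmem, hnext⟩ := hf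
  simp only [List.map_cons, List.map_nil, List.rotate_singleton, List.cons.injEq, and_true,
    List.mem_singleton, forall_eq] at hnext hmem
  obtain ⟨h1, h2⟩ := TangleCode.consec_of_faceNext hT.nodup hmem hnext
  rw [loopOver_eq hk h2]
  cases f
  · exact ⟨p.other, by simpa [Passage.other_other] using h1, rfl, rfl⟩
  · exact ⟨p, by simpa using h1, rfl, rfl⟩

theorem bigon_spec (hT : T.IsDiagram) {p q : Passage} {f g : Bool}
    (hf : T.HasFace [(p, f), (q, g)]) (hpq : p.isOver ≠ q.isOver) (hk : k.OfBigon p f g)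
    (o : Bool) : ∃ x y, x.isOver = o ∧ y.isOver = o ∧ T.Consec x y ∧
      (T.Consec x.other y.other ∨ T.Consec y.other x.other) ∧ x.positive = k.bigonSign o ∧
      (y.positive = !k.bigonSign o) ∧ T.erase [p.crossing, q.crossing] =
        T.erase [x.crossing, y.crossing] := by
  obtain ⟨-, hmem, hnext⟩ := hf
  have hr : ∀ a b : Dart n, [a, b].rotate 1 = [b, a] := fun _ _ => rfl
  simp only [List.map_cons, List.map_nil, hr, List.cons.injEq, and_true, List.mem_cons,
    List.not_mem_nil, or_false, forall_eq_or_imp, forall_eq] at hnext hmem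
  obtain ⟨h1, h2⟩ := TangleCode.consec_of_faceNext hT.nodup hmem.1 hnext.1
  obtain ⟨h3, h4⟩ := TangleCode.consec_of_faceNext hT.nodup hmem.2 hnext.2
  have hpq' : p.isOver = !q.isOver := by
    revert hpq
    cases p.isOver <;> cases q.isOver <;> simp
  obtain ⟨h5, h6, h7⟩ := bigonSign_eq hk hpq' h2 h4
  by_cases hp : p.isOver = o
  · subst hp
    exact bigon_edge hpq' h1 h3 h5 h7
  · have hq : q.isOver = o := by
      revert hp hpq
      cases p.isOver <;> cases q.isOver <;> cases o <;> simp
    subst hq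
    rw [TangleCode.erase_congr (t := [q.crossing, p.crossing]) fun c => by simp [or_comm]]
    exact bigon_edge (by rw [hpq', Bool.not_not]) h3 h1 h6 (by rw [h7, Bool.not_not])

/-- The three pairs are the ends of the three edges of the triangle. Only the edge on the top strand
has two over-passages and only the one on the bottom strand has two under-passages, so just one of
the three statements has content for a given `o`. -/
theorem sameSign_spec {p q r : Passage} {f g h : Bool} (hp : p.isOver = true)
    (hq : q.isOver = false) (hk : OfTriangle p q r f g h k) (o : Bool) :
    (r.isOver = o → p.other.isOver = o → k.SameSign o → r.positive = p.other.positive) ∧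
    (q.isOver = o → r.other.isOver = o → k.SameSign o → q.positive = r.other.positive) ∧
    (p.isOver = o → q.other.isOver = o → k.SameSign o → p.positive = q.other.positive) := by
  rcases p with ⟨c, _, ps⟩
  rcases q with ⟨d, _, qs⟩
  obtain rfl := hp
  obtain rfl := hq
  cases k <;> try exact hk.elim
  all_goals
    rcases r with ⟨e, _ | _, _ | _⟩ <;> cases ps <;> cases qs <;> revert hk <;>
      simp [Passage.other, OfTriangle, SameSign] <;> cases o <;> simp

/-- The triangle is inverted one edge at a time. The two intermediate codes need not be planar, so
only the absence of repeated passages is carried along. -/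
theorem triangle_spec (hT : T.IsDiagram) {p q r : Passage} {f g h : Bool}
    (hf : T.HasFace [(p, f), (q, g), (r, h)]) :
    ∃ T₁ T₂, T.passages.Nodup ∧ T₁.passages.Nodup ∧ T₂.passages.Nodup ∧
      (T.Interchange T₁ r p.other ∨ T.Interchange T₁ p.other r) ∧
      (T₁.Interchange T₂ q r.other ∨ T₁.Interchange T₂ r.other q) ∧
      (T₂.Interchange (T.permute (Equiv.swap p q.other *
          (Equiv.swap q r.other * Equiv.swap r p.other))) p q.other ∨
        T₂.Interchange (T.permute (Equiv.swap p q.other *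
          (Equiv.swap q r.other * Equiv.swap r p.other))) q.other p) := by
  obtain ⟨hc, hmem, hnext⟩ := hf
  have hr : ∀ a b c : Dart n, [a, b, c].rotate 1 = [b, c, a] := fun _ _ _ => rfl
  simp only [List.map_cons, List.map_nil, hr, List.cons.injEq, and_true, List.mem_cons,
    List.not_mem_nil, or_false, forall_eq_or_imp, forall_eq, List.nodup_cons, not_or,
    not_false_eq_true, List.nodup_nil] at hc hnext hmem
  obtain ⟨⟨hpq, hpr⟩, hqr⟩ := hc
  have h1 := (TangleCode.consec_of_faceNext hT.nodup hmem.1 hnext.1).1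
  have h2 := (TangleCode.consec_of_faceNext hT.nodup hmem.2.1 hnext.2.1).1
  have h3 := (TangleCode.consec_of_faceNext hT.nodup hmem.2.2 hnext.2.2).1
  have key : ∀ {T : TangleCode n} {x y : Passage} {f : Bool}, T.passages.Nodup →
      (if f then T.Consec x y else T.Consec y x) → x.crossing ≠ y.crossing →
      (T.Interchange (T.permute (Equiv.swap x y)) x y ∨
        T.Interchange (T.permute (Equiv.swap x y)) y x) := by
    intro T x y f hn h hxy
    cases f
    · rw [Equiv.swap_comm]
      exact .inr (TangleCode.interchange_permute hn (by simpa using h) hxy.symm)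
    · exact .inl (TangleCode.interchange_permute hn (by simpa using h) hxy)
  -- An edge with neither end in the transposed pair remains an edge, so the three interchanges do
  -- not disturb one another.
  have move : ∀ {T : TangleCode n} {x y a b : Passage} {f : Bool},
      (if f then T.Consec x y else T.Consec y x) → x ≠ a → x ≠ b → y ≠ a → y ≠ b →
      (if f then (T.permute (Equiv.swap a b)).Consec x y
        else (T.permute (Equiv.swap a b)).Consec y x) := by
    intro T x y a b f h hxa hxb hya hyb
    cases f
    · simpa [Equiv.swap_apply_of_ne_of_ne, *] using
        TangleCode.Consec.permute (by simpa using h : T.Consec y x) (Equiv.swap a b)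
    · simpa [Equiv.swap_apply_of_ne_of_ne, *] using
        TangleCode.Consec.permute (by simpa using h : T.Consec x y) (Equiv.swap a b)
  have ne : ∀ {x y : Passage}, x.crossing ≠ y.crossing → x ≠ y := fun h e => h (e ▸ rfl)
  have hr' := r.other_ne
  have hq' := q.other_ne
  have hp' := p.other_ne
  have n1 := TangleCode.permute_nodup hT.nodup (Equiv.swap r p.other)
  have n2 := TangleCode.permute_nodup n1 (Equiv.swap q r.other)
  refine ⟨_, _, hT.nodup, n1, n2, key hT.nodup h3 (Ne.symm hpr),
    key n1 (move h2 (ne hqr) (ne (Ne.symm hpq)) r.other_ne (ne (Ne.symm hpr))) hqr, ?_⟩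
  rw [TangleCode.permute_mul, TangleCode.permute_mul]
  exact key n2 (move (move h1 (ne hpr) p.other_ne.symm (ne hqr)
    (fun e => hpq (congrArg Passage.crossing e).symm)) (ne hpq) (ne hpr) q.other_ne
    fun e => hqr (by simpa using congrArg Passage.crossing (Passage.other_injective e))) hpq

end Move

/-! ### Invariants from words along the strands -/

theorem prod_map_filter {α M : Type*} [Monoid M] (g : α → M) (P : α → Bool) (l : List α)
    (h : ∀ x ∈ l, P x = false → g x = 1) : ((l.filter P).map g).prod = (l.map g).prod := by
  induction l with
  | nil => rfl
  | cons x l ih =>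
    have ih := ih fun y hy => h y (List.mem_cons_of_mem _ hy)
    by_cases hx : P x
    · simp [hx, ih]
    · simp [hx, ih, h x List.mem_cons_self (by simpa using hx)]

/-- Only the product of the adjacent pair has to be trivial, in the order in which it occurs; this
is what allows letters with a one-sided inverse. -/
theorem prod_map_filter_pair {α M : Type*} [Monoid M] (g : α → M) (P : α → Bool) {l u v : List α}
    {x y : α} (hl : l = u ++ x :: y :: v) (hx : P x = false) (hy : P y = false)
    (hxy : g x * g y = 1) (h : ∀ z ∈ u ++ v, P z = false → g z = 1) :
    ((l.filter P).map g).prod = (l.map g).prod := by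
  subst hl
  have hu := prod_map_filter g P u fun z hz => h z (by simp [hz])
  have hv := prod_map_filter g P v fun z hz => h z (by simp [hz])
  have h1 : (g x * (g y * (v.map g).prod)) = (v.map g).prod := by
    rw [← mul_assoc, hxy, one_mul]
  simp [hx, hy, hu, hv, h1]

/-- A value in a monoid for every passage of a diagram, that does not depend on the names of the
crossings, on other crossings, and on the order of consecutive passages. -/
structure Weight (n : ℕ) (M : Type*) where
  val : TangleCode n → Passage → M
  rename : ∀ (T T' : TangleCode n) (σ : Equiv.Perm ℕ),
    (∀ i, T'.strand i = (T.strand i).map (Passage.rename σ)) →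
      ∀ p, val T' (p.rename σ) = val T p
  erase : ∀ (T : TangleCode n) (s : List ℕ) (p : Passage), p.crossing ∉ s →
    val (T.erase s) p = val T p
  interchange : ∀ (T T' : TangleCode n) (x y : Passage), T.passages.Nodup →
    T.Interchange T' x y → ∀ p, val T' p = val T p

namespace Weight

variable {n : ℕ} {M : Type*} [Monoid M] (w : Weight n M)

/-- The product of the values along a strand. -/
def word (T : TangleCode n) (i : Fin n) : M := ((T.strand i).map (w.val T)).prod

theorem word_isotopic {T T' : TangleCode n} (h : T.Isotopic T') (i : Fin n) :
    w.word T' i = w.word T i := by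
  obtain ⟨-, σ, hσ⟩ := h
  simp only [word, hσ, List.map_map]
  congr 2
  funext p
  exact w.rename T T' σ hσ p

theorem word_interchange {T T' : TangleCode n} {x y : Passage} (hT : T.passages.Nodup)
    (h : T.Interchange T' x y) (hxy : Commute (w.val T x) (w.val T y)) (i : Fin n) :
    w.word T' i = w.word T i := by
  have hval : w.val T' = w.val T := funext (w.interchange T T' x y hT h)
  obtain ⟨-, j, u, v, h1, h2, h3⟩ := h
  unfold word
  rw [hval]
  by_cases hij : i = j
  · subst hij
    rw [h1, h2]
    simp only [List.map_append, List.map_cons, List.prod_append, List.prod_cons]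
    rw [← mul_assoc (w.val T y), ← mul_assoc (w.val T x), hxy.eq]
  · rw [h3 i hij]

theorem word_erase_eq (T : TangleCode n) (s : List ℕ) (i : Fin n) : w.word (T.erase s) i =
    (((T.strand i).filter fun p => p.crossing ∉ s).map (w.val T)).prod := by
  unfold word
  refine congrArg List.prod (List.map_congr_left fun p hp => w.erase T s p ?_)
  simpa using (List.mem_filter.1 hp).2

/-- The effect of the moves on words: the weight is nontrivial only on over-passages (`o = true`)
or only on under-passages (`o = false`), and it is trivial on loops, inverse on the two crossings of
a bigon, and commutes on the two crossings of a strand in a triangle. -/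
theorem word_step {o : Bool} (ho : ∀ T p, p.isOver ≠ o → w.val T p = 1) (i : Fin n) {k : Move}
    {T T' : TangleCode n} (hT : T.IsDiagram) (h : k.Step T T')
    (h₁ : k.strands = 1 → ∀ x, T.Consec x x.other → x.isOver = k.loopOver → x ∈ T.strand i →
      w.val T x = 1 ∧ w.val T x.other = 1)
    (h₂ : k.strands = 2 → ∀ x y, x.isOver = o → y.isOver = o → T.Consec x y →
      (T.Consec x.other y.other ∨ T.Consec y.other x.other) → x.positive = k.bigonSign o →
      (y.positive = !k.bigonSign o) → w.val T x * w.val T y = 1)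
    (h₃ : k.strands = 3 → ∀ x y, x.isOver = o → y.isOver = o →
      (k.SameSign o → x.positive = y.positive) → Commute (w.val T x) (w.val T y)) :
    w.word T' i = w.word T i := by
  obtain ⟨p, f, hf, hk, rfl⟩ | ⟨p, q, f, g, hf, hpq, hk, rfl⟩ |
    ⟨p, q, r, f, g, h, hf, hp, hq, hk, rfl⟩ := h
  · obtain ⟨x, hx, hxo, hxc⟩ := Move.loop_spec hT hf hk
    have h1 := h₁ (Move.strands_of_ofMonogon hk) x hx hxo
    rw [word_erase_eq, word]
    refine prod_map_filter _ _ _ fun z hz hzc => ?_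
    have hzc : z.crossing = x.crossing := by simpa [hxc] using hzc
    have hzm : z ∈ T.passages := TangleCode.mem_passages.2 ⟨i, hz⟩
    obtain rfl | rfl := hT.eq_or_eq_other hzm hx.mem_left hzc
    · exact (h1 hz).1
    · exact (h1 ((hx.mem_strand_iff hT.nodup i).2 hz)).2
  · obtain ⟨x, y, hxo, hyo, hxy, hxy', hxs, hys, he⟩ := Move.bigon_spec hT hf hpq hk o
    have h2 := h₂ (Move.strands_of_ofBigon hk) x y hxo hyo hxy hxy' hxs hys
    rw [he, word_erase_eq, word]
    -- Apart from `x` and `y`, the erased passages are those of the other edge of the bigon, of the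
    -- kind on which the weight is trivial.
    have hone : ∀ z ∈ T.strand i, z ≠ x → z ≠ y →
        decide (z.crossing ∉ [x.crossing, y.crossing]) = false → w.val T z = 1 := by
      intro z hz hzx hzy hzc
      have hzm : z ∈ T.passages := TangleCode.mem_passages.2 ⟨i, hz⟩
      have hzc : z.crossing = x.crossing ∨ z.crossing = y.crossing := by
        simpa [-not_or, ← or_iff_not_imp_left] using hzc
      refine ho T z ?_
      obtain hzc | hzc := hzc
      · rw [(hT.eq_or_eq_other hzm hxy.mem_left hzc).resolve_left hzx, ← hxo]
        simp [Passage.other]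
      · rw [(hT.eq_or_eq_other hzm hxy.mem_right hzc).resolve_left hzy, ← hyo]
        simp [Passage.other]
    by_cases hxi : x ∈ T.strand i
    · obtain ⟨j, u, v, huv⟩ := hxy
      obtain rfl : j = i := TangleCode.eq_of_mem_strand hT.nodup (by simp [huv]) hxi
      refine prod_map_filter_pair _ _ huv (by simp) (by simp) h2 fun z hz => hone z ?_ ?_ ?_
      · rw [huv]
        simp only [List.mem_append, List.mem_cons] at hz ⊢
        tauto
      all_goals
        rintro rfl
        have hnd := TangleCode.strand_nodup hT.nodup j
        rw [huv] at hnd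
        simp only [List.nodup_append, List.nodup_cons, List.mem_cons, not_or] at hnd
        obtain ⟨-, ⟨⟨-, hxv⟩, hyv, -⟩, hd⟩ := hnd
        simp only [List.mem_append] at hz
        obtain hz | hz := hz
        · exact hd _ hz _ (by simp) rfl
        · first | exact hxv hz | exact hyv hz
    · have hyi := mt (hxy.mem_strand_iff hT.nodup i).2 hxi
      exact prod_map_filter _ _ _ fun z hz =>
        hone z hz (fun e => hxi (e ▸ hz)) fun e => hyi (e ▸ hz)
  · have h3 := h₃ (Move.strands_of_ofTriangle hk)
    obtain ⟨T₁, T₂, n0, n1, n2, s1, s2, s3⟩ := Move.triangle_spec hT hf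
    have hstep : ∀ {T T' : TangleCode n} {x y : Passage}, T.passages.Nodup →
        (T.Interchange T' x y ∨ T.Interchange T' y x) → Commute (w.val T x) (w.val T y) →
        w.val T' = w.val T ∧ w.word T' i = w.word T i := by
      intro T T' x y hn h hc
      obtain h | h := h
      · exact ⟨funext (w.interchange T T' x y hn h), w.word_interchange hn h hc i⟩
      · exact ⟨funext (w.interchange T T' y x hn h), w.word_interchange hn h hc.symm i⟩
    have hcomm : ∀ x y : Passage, (x.isOver = o → y.isOver = o → k.SameSign o →
        x.positive = y.positive) → Commute (w.val T x) (w.val T y) := by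
      intro x y hxy
      by_cases hx : x.isOver = o
      · by_cases hy : y.isOver = o
        · exact h3 x y hx hy (hxy hx hy)
        · rw [ho T y hy]
          exact Commute.one_right _
      · rw [ho T x hx]
        exact Commute.one_left _
    have hsign := Move.sameSign_spec hp hq hk o
    -- Interchanges preserve the weight, so commutation at the intermediate codes reduces to
    -- commutation in `T`.
    obtain ⟨e1, d1⟩ := hstep n0 s1 (hcomm r p.other hsign.1)
    obtain ⟨e2, d2⟩ := hstep n1 s2 (by rw [e1]; exact hcomm q r.other hsign.2.1)
    obtain ⟨e3, d3⟩ := hstep n2 s3 (by rw [e2, e1]; exact hcomm p q.other hsign.2.2)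
    rw [d3, d2, d1]

end Weight

theorem Passage.rename_injective (σ : Equiv.Perm ℕ) : Function.Injective (Passage.rename σ) := by
  rintro ⟨c, o, s⟩ ⟨d, o', s'⟩ h
  simpa [Passage.rename] using h

namespace TangleCode

variable {n : ℕ}

theorem Interchange.mem_strand {T T' : TangleCode n} {x y : Passage} (h : T.Interchange T' x y)
    (i : Fin n) (p : Passage) : p ∈ T'.strand i ↔ p ∈ T.strand i := by
  obtain ⟨-, j, u, v, h1, h2, h3⟩ := h
  by_cases hij : i = j
  · subst hij
    simp only [h1, h2, List.mem_append, List.mem_cons]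
    tauto
  · rw [h3 i hij]

/-- Only the passages through the crossing of `p` matter, and interchanging passages of two
different crossings does not change their order. -/
theorem Interchange.pair_sublist {T T' : TangleCode n} {x y : Passage} (h : T.Interchange T' x y)
    (i : Fin n) (p : Passage) :
    [p, p.other].Sublist (T'.strand i) ↔ [p, p.other].Sublist (T.strand i) := by
  have key : ∀ l : List Passage, [p, p.other].Sublist l ↔
      [p, p.other].Sublist (l.filter fun z => z.crossing = p.crossing) := fun l =>
    ⟨fun h => by simpa [Passage.other] using h.filter fun z => decide (z.crossing = p.crossing),
      fun h => h.trans List.filter_sublist⟩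
  obtain ⟨hc, j, u, v, h1, h2, h3⟩ := h
  by_cases hij : i = j
  · subst hij
    rw [key, key (T.strand i), h1, h2]
    by_cases hx : x.crossing = p.crossing
    · have hy : y.crossing ≠ p.crossing := fun e => hc (hx.trans e.symm)
      simp [hx, hy]
    · simp [List.filter_cons, hx]
  · rw [h3 i hij]

end TangleCode

namespace Weight

variable {n : ℕ} {M : Type*} [Monoid M]

open Classical in
/-- Letters for the crossings with strand `j` and strand `j'`, depending on the sign, where only
over-passages (`o = true`) or only under-passages (`o = false`) are counted. -/
noncomputable def mixed (o : Bool) (j j' : Fin n) (L L' : Bool → M) : Weight n M where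
  val T p := if p.isOver = o then
    if p.other ∈ T.strand j then L p.positive
    else if p.other ∈ T.strand j' then L' p.positive else 1 else 1
  rename T T' σ h p := by
    have hm : ∀ i, (p.rename σ).other ∈ T'.strand i ↔ p.other ∈ T.strand i := fun i => by
      rw [h]
      exact List.mem_map_of_injective (Passage.rename_injective σ) (a := p.other)
    simp only [hm]
    rfl
  erase T s p hp := by
    have hm : ∀ i, p.other ∈ (T.erase s).strand i ↔ p.other ∈ T.strand i := fun i => by
      simp [TangleCode.erase, Passage.other, hp]
    simp only [hm]
  interchange T T' x y _ h p := by
    simp only [h.mem_strand]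

open Classical in
/-- Letters for the crossings of strand `i` with itself, at the first passage if it is an
over-passage (`o = true`) or an under-passage (`o = false`). -/
noncomputable def order (o : Bool) (i : Fin n) (L : Bool → M) : Weight n M where
  val T p := if p.isOver = o ∧ [p, p.other].Sublist (T.strand i) then L p.positive else 1
  rename T T' σ h p := by
    have hm : [p.rename σ, (p.rename σ).other].Sublist (T'.strand i) ↔
        [p, p.other].Sublist (T.strand i) := by
      rw [h, show [p.rename σ, (p.rename σ).other] = [p, p.other].map (Passage.rename σ) from rfl]
      refine ⟨fun h => ?_, fun h => h.map _⟩
      obtain ⟨l, hl, e⟩ := List.sublist_map_iff.1 h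
      rwa [List.map_injective_iff.2 (Passage.rename_injective σ) e]
    simp only [hm]
    rfl
  erase T s p hp := by
    have hm : [p, p.other].Sublist ((T.erase s).strand i) ↔ [p, p.other].Sublist (T.strand i) :=
      ⟨fun h => h.trans List.filter_sublist, fun h => by
        simpa [Passage.other, hp, TangleCode.erase] using h.filter fun z => decide (z.crossing ∉ s)⟩
    simp only [hm]
  interchange T T' x y _ h p := by
    simp only [h.pair_sublist]

theorem word_eq_of_realizedBy (w : Weight n M) (i : Fin n) {S : Finset Move}
    (hS : ∀ k ∈ S, ∀ T T' : TangleCode n, T.IsDiagram → k.Step T T' → w.word T' i = w.word T i)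
    {D D' : {T : TangleCode n // T.IsDiagram}}
    (h : Relation.EqvGen (fun D D' : {T : TangleCode n // T.IsDiagram} =>
      TangleCode.Isotopic D.1 D'.1 ∨ ∃ k ∈ S, k.Step D.1 D'.1) D D') :
    w.word D'.1 i = w.word D.1 i := by
  induction h with
  | rel D D' h =>
    obtain h | ⟨k, hk, h⟩ := h
    · exact w.word_isotopic h i
    · exact hS k hk _ _ D.2 h
  | refl => rfl
  | symm _ _ _ ih => exact ih.symm
  | trans _ _ _ _ _ ih₁ ih₂ => exact ih₂.trans ih₁

/-- On the word along strand `i` of the letters for the crossings with two other strands. -/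
theorem mixed_word_step {o : Bool} {i j j' : Fin n} (hj : j ≠ i) (hj' : j' ≠ i) {L L' : Bool → M}
    {k : Move} (h₂ : k.strands = 2 → ∀ l ∈ [L, L'], l (k.bigonSign o) * l (!k.bigonSign o) = 1)
    (h₃ : k.strands = 3 → k.SameSign o ∧ L' = 1 ∨ ∀ a b, Commute (L a) (L b) ∧ L' = 1)
    {T T' : TangleCode n} (hT : T.IsDiagram) (h : k.Step T T') :
    (mixed o j j' L L').word T' i = (mixed o j j' L L').word T i := by
  refine word_step _ (o := o) (fun T p hp => if_neg hp) i hT h ?_ ?_ ?_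
  · intro _ x hx _ hxi
    have hxi' := (hx.mem_strand_iff hT.nodup i).1 hxi
    -- The loop is a crossing of strand `i` with itself, while letters are given only to crossings
    -- with strands `j`, `j'` different from `i`.
    have h1 : ∀ y ∈ T.strand i, ∀ l ≠ i, y ∉ T.strand l := fun y hy l hl h =>
      hl (TangleCode.eq_of_mem_strand hT.nodup h hy)
    simp [mixed, Passage.other_other, h1 _ hxi _ hj, h1 _ hxi _ hj', h1 _ hxi' _ hj,
      h1 _ hxi' _ hj']
  · intro hk x y hx hy _ hxy hxs hys
    have hm : ∀ l, x.other ∈ T.strand l ↔ y.other ∈ T.strand l := fun l =>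
      hxy.elim (fun h => h.mem_strand_iff hT.nodup l) fun h => (h.mem_strand_iff hT.nodup l).symm
    have h2 := h₂ hk
    simp only [mixed, hx, hy, hm, if_true, hxs, hys]
    split_ifs
    · exact h2 L (by simp)
    · exact h2 L' (by simp)
    · exact one_mul 1
  · intro hk x y hx hy hxy
    simp only [mixed, hx, hy, if_true]
    obtain ⟨hs, rfl⟩ | h := h₃ hk
    · simp only [hxy hs]
      split_ifs <;>
        first | exact Commute.refl _ | exact Commute.one_right _ | exact Commute.one_left _
    · obtain rfl := (h true true).2
      split_ifs <;> first | exact (h _ _).1 | exact Commute.one_right _ | exact Commute.one_left _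

end Weight

/-! ### Order of the two passages at self-crossings -/

theorem pair_sublist_iff_idxOf_lt {α : Type*} [DecidableEq α] {l : List α} (hl : l.Nodup) {x y : α}
    (hx : x ∈ l) (hy : y ∈ l) (hxy : x ≠ y) : [x, y].Sublist l ↔ l.idxOf x < l.idxOf y := by
  induction l with
  | nil => simp at hx
  | cons z l ih =>
    rw [List.nodup_cons] at hl
    by_cases hzx : z = x
    · subst hzx
      have hy' : y ∈ l := by simpa [hxy.symm] using hy
      simp [List.idxOf_cons_ne _ hxy, List.singleton_sublist, hy']
    · have hx' : x ∈ l := by simpa [Ne.symm hzx] using hx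
      by_cases hzy : z = y
      · subst hzy
        simp only [List.idxOf_cons_self, not_lt_zero, iff_false]
        intro h
        cases h with
        | cons _ h => exact hl.1 (h.subset (by simp))
        | cons_cons _ h => exact hzx rfl
      · have hy' : y ∈ l := by simpa [Ne.symm hzy] using hy
        rw [List.idxOf_cons_ne _ hzx, List.idxOf_cons_ne _ hzy, Nat.succ_lt_succ_iff,
          ← ih hl.2 hx' hy']
        exact ⟨fun h => by
          cases h with
          | cons _ h => exact h
          | cons_cons _ h => exact absurd rfl hzx, fun h => h.cons _⟩

theorem TangleCode.Consec.idxOf {n : ℕ} {T : TangleCode n} (hT : T.passages.Nodup) {x y : Passage}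
    (h : T.Consec x y) (i : Fin n) (hx : x ∈ T.strand i) :
    (T.strand i).idxOf y = (T.strand i).idxOf x + 1 := by
  obtain ⟨j, u, v, hj⟩ := h
  obtain rfl : j = i := TangleCode.eq_of_mem_strand hT (by simp [hj]) hx
  have hnd := TangleCode.strand_nodup hT j
  rw [hj] at hnd ⊢
  simp only [List.nodup_append, List.nodup_cons, List.mem_cons, not_or] at hnd
  obtain ⟨-, ⟨⟨hxy, -⟩, -⟩, hd⟩ := hnd
  rw [List.idxOf_append_of_notMem fun h => hd _ h _ (.inr (.inl rfl)) rfl,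
    List.idxOf_append_of_notMem fun h => hd _ h _ (.inl rfl) rfl, List.idxOf_cons_ne _ hxy]
  simp

/-- The two crossings of a bigon are first passed on the same edge of the bigon. -/
theorem TangleCode.pair_sublist_iff {n : ℕ} {T : TangleCode n} (hT : T.IsDiagram) {x y : Passage}
    (ho : x.isOver = y.isOver) (h : T.Consec x y)
    (h' : T.Consec x.other y.other ∨ T.Consec y.other x.other) (i : Fin n) :
    [x, x.other].Sublist (T.strand i) ↔ [y, y.other].Sublist (T.strand i) := by
  have hm := h.mem_strand_iff hT.nodup i
  have hm' : x.other ∈ T.strand i ↔ y.other ∈ T.strand i :=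
    h'.elim (fun h => h.mem_strand_iff hT.nodup i) fun h => (h.mem_strand_iff hT.nodup i).symm
  by_cases hx : x ∈ T.strand i ∧ x.other ∈ T.strand i
  · have hnd := TangleCode.strand_nodup hT.nodup i
    have hy := hm.1 hx.1
    have hy' := hm'.1 hx.2
    have hne : ∀ {a b : Passage}, a ∈ T.strand i → a ≠ b →
        (T.strand i).idxOf a ≠ (T.strand i).idxOf b := fun ha hab e =>
      hab ((List.idxOf_inj ha).1 e)
    have d1 := hne hx.2 (b := x) x.other_ne
    have d2 := hne hy' (b := y) y.other_ne
    have d3 := hne hx.2 (b := y) fun e => by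
      have := congrArg Passage.isOver e
      simp [Passage.other, ho] at this
    have d4 := hne hy' (b := x) fun e => by
      have := congrArg Passage.isOver e
      simp [Passage.other, ho] at this
    rw [pair_sublist_iff_idxOf_lt hnd hx.1 hx.2 x.other_ne.symm,
      pair_sublist_iff_idxOf_lt hnd hy hy' y.other_ne.symm]
    have e1 := h.idxOf hT.nodup i hx.1
    -- The positions of `x`, `y` and those of their other passages are two disjoint pairs of
    -- neighbours, so one pair lies entirely before the other.
    obtain h' | h' := h'
    · have e2 := h'.idxOf hT.nodup i hx.2
      omega
    · have e2 := h'.idxOf hT.nodup i hy'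
      omega
  · refine iff_of_false (fun h => hx ⟨h.subset (by simp), h.subset (by simp)⟩) fun h => hx ?_
    exact ⟨hm.2 (h.subset (by simp)), hm'.2 (h.subset (by simp))⟩

/-- On the sum of the signs of the crossings of a strand with itself that are first passed over
(`o = true`) or under (`o = false`). -/
theorem Weight.order_word_step {M : Type*} [CommMonoid M] {n : ℕ} {o : Bool} {i : Fin n}
    {L : Bool → M} (hL : L true * L false = 1) {k : Move}
    (h₁ : k.strands = 1 → k.loopOver ≠ o) {T T' : TangleCode n} (hT : T.IsDiagram)
    (h : k.Step T T') : (order o i L).word T' i = (order o i L).word T i := by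
  refine word_step _ (o := o) (fun T p hp => if_neg fun h => hp h.1) i hT h ?_ ?_ ?_
  · intro hk x hx hxo hxi
    have hxi' := (hx.mem_strand_iff hT.nodup i).1 hxi
    -- The second passage `x.other` of the loop is never counted, and the first passage `x` is of
    -- the kind opposite to `o`.
    have hlt : ¬ [x.other, x].Sublist (T.strand i) := by
      rw [pair_sublist_iff_idxOf_lt (TangleCode.strand_nodup hT.nodup i) hxi' hxi x.other_ne,
        hx.idxOf hT.nodup i hxi]
      omega
    have hxo' : x.isOver ≠ o := hxo ▸ h₁ hk
    simp [order, Passage.other_other, hxo', hlt]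
  · intro hk x y hx hy hxy hxy' hxs hys
    have hm := TangleCode.pair_sublist_iff hT (hx.trans hy.symm) hxy hxy' i
    simp only [order, hx, hy, hm, true_and, hxs, hys]
    split_ifs
    · cases k.bigonSign o
      · simpa [mul_comm] using hL
      · simpa using hL
    · exact one_mul 1
  · intro _ x y _ _ _
    exact Commute.all _ _

/-! ### Generating sets -/

/-- Without a loop of kind `o`, the signed count of self-crossings first passed in the way `o` is
invariant; but Ω1a changes it for `o = true`, and Ω1b for `o = false`. -/
theorem IsGenerating.exists_loop {S : Finset Move} (hS : IsGenerating S) (o : Bool) :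
    ∃ k ∈ S, k.strands = 1 ∧ k.loopOver = o := by
  by_contra! h
  let L : Bool → Multiplicative ℤ := fun b => Multiplicative.ofAdd (if b then 1 else -1)
  have key : ∀ k ∈ S, ∀ T T' : TangleCode 1, T.IsDiagram → k.Step T T' →
      (Weight.order o 0 L).word T' 0 = (Weight.order o 0 L).word T 0 :=
    fun k hk T T' hT hs => Weight.order_word_step (by decide) (h k hk) hT hs
  cases o
  · have := Weight.word_eq_of_realizedBy _ 0 key (hS .Ω1b)
    revert this
    simp [Weight.word, Weight.order, Move.source, Move.target, Move.strands, Passage.other, L]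
    decide
  · have := Weight.word_eq_of_realizedBy _ 0 key (hS .Ω1a)
    revert this
    simp [Weight.word, Weight.order, Move.source, Move.target, Move.strands, Passage.other, L]
    decide

/-- Only moves of type 2 change the unsigned number of under-passages of one strand below another.
-/
theorem IsGenerating.exists_bigon {S : Finset Move} (hS : IsGenerating S) :
    ∃ k ∈ S, k.strands = 2 := by
  by_contra! h
  let L : Bool → Multiplicative ℤ := fun _ => Multiplicative.ofAdd 1
  have key : ∀ k ∈ S, ∀ T T' : TangleCode 2, T.IsDiagram → k.Step T T' →
      (Weight.mixed false 0 0 L 1).word T' 1 = (Weight.mixed false 0 0 L 1).word T 1 :=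
    fun k hk T T' hT hs => Weight.mixed_word_step (by decide) (by decide)
      (fun h2 => absurd h2 (h k hk)) (fun _ => .inr fun _ _ => ⟨Commute.all _ _, rfl⟩) hT hs
  have := Weight.word_eq_of_realizedBy _ 1 key (hS .Ω2a)
  revert this
  simp [Weight.word, Weight.mixed, Move.source, Move.target, Move.strands, Passage.other, L]
  decide

/-- Crossings of the bottom strand with the two other strands are recorded by two involutions that
do not commute. Bigons contribute squares, which are trivial, but Ω3b reverses the two-letter word.
-/
theorem IsGenerating.exists_triangle {S : Finset Move} (hS : IsGenerating S) :
    ∃ k ∈ S, k.strands = 3 := by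
  by_contra! h
  let L : Bool → Equiv.Perm (Fin 3) := fun _ => Equiv.swap 0 1
  let L' : Bool → Equiv.Perm (Fin 3) := fun _ => Equiv.swap 1 2
  have key : ∀ k ∈ S, ∀ T T' : TangleCode 3, T.IsDiagram → k.Step T T' →
      (Weight.mixed false 0 1 L L').word T' 2 = (Weight.mixed false 0 1 L L').word T 2 :=
    fun k hk T T' hT hs => Weight.mixed_word_step (by decide) (by decide)
      (fun _ l hl => by
        simp only [List.mem_cons, List.not_mem_nil, or_false] at hl
        obtain rfl | rfl := hl <;> exact Equiv.swap_mul_self _ _)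
      (fun h3 => absurd h3 (h k hk)) hT hs
  have := Weight.word_eq_of_realizedBy _ 2 key (hS .Ω3b)
  revert this
  simp [Weight.word, Weight.mixed, Move.source, Move.target, Move.strands, Passage.other, L, L']
  decide

/-- Generators of the bicyclic monoid: the letter of `s` is a left inverse of the other letter. -/
def bicyclicLetter (s b : Bool) : Function.End ℕ := bif b == s then Nat.pred else Nat.succ

/-- Multiplication in `Function.End` is composition, and predecessor after successor is the
identity. -/
theorem bicyclicLetter_mul (s : Bool) : bicyclicLetter s s * bicyclicLetter s (!s) = 1 := by
  cases s <;> rfl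

theorem bicyclicLetter_mul_ne (s : Bool) : bicyclicLetter s (!s) * bicyclicLetter s s ≠ 1 := by
  intro h
  -- Truncation at zero makes the opposite composite fail: the successor of `Nat.pred 0` is `1`.
  have := congrFun h 0
  cases s <;> exact absurd this (by decide)

/-- With a single move of type 2 and a single move of type 3, the latter not well-oriented, one of
the moves of type 2 is not realized. -/
theorem not_isGenerating_of_sameSign {S : Finset Move} {o : Bool} {k : Move}
    (h₂ : ∀ l ∈ S, l.strands = 2 → l = k) (h₃ : ∀ l ∈ S, l.strands = 3 → l.SameSign o) :
    ¬ IsGenerating S := by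
  intro hS
  let L := bicyclicLetter (k.bigonSign o)
  -- In the sources of Ω2a and Ω2b strand 0 lies over strand 1, so `i` is the strand whose passages
  -- are of kind `o`.
  let i : Fin 2 := if o then 0 else 1
  let j : Fin 2 := if o then 1 else 0
  have hij : j ≠ i := by cases o <;> simp [i, j]
  have key : ∀ l ∈ S, ∀ T T' : TangleCode 2, T.IsDiagram → l.Step T T' →
      (Weight.mixed o j j L 1).word T' i = (Weight.mixed o j j L 1).word T i :=
    fun l hl T T' hT hs => Weight.mixed_word_step hij hij
      (fun h2 L₁ hL => by
        simp only [List.mem_cons, List.not_mem_nil, or_false] at hL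
        obtain rfl | rfl := hL
        · rw [h₂ l hl h2]
          exact bicyclicLetter_mul _
        · exact one_mul 1)
      (fun h3 => .inl ⟨h₃ l hl h3, rfl⟩) hT hs
  have hne : L (!k.bigonSign o) * L (k.bigonSign o) ≠ 1 := bicyclicLetter_mul_ne _
  apply hne
  clear_value L
  -- Of Ω2a and Ω2b, the one whose signs occur in the order opposite to that of `k` is used; its
  -- source has the nontrivial word and its target the empty word.
  cases hs : k.bigonSign o
  · have := Weight.word_eq_of_realizedBy _ i key (hS .Ω2a)
    cases o <;> revert this <;>
      simp [Weight.word, Weight.mixed, Move.source, Move.target, Move.strands, Passage.other, i, j]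
    all_goals exact Eq.symm
  · have := Weight.word_eq_of_realizedBy _ i key (hS .Ω2b)
    cases o <;> revert this <;>
      simp [Weight.word, Weight.mixed, Move.source, Move.target, Move.strands, Passage.other, i, j]
    all_goals exact Eq.symm

/-- In Ω3a and Ω3h both the top and the bottom strand meet crossings of opposite signs; these are
the only moves of type 3 with this property. -/
theorem Move.exists_sameSign {k : Move} (h : k.strands = 3) (ha : k ≠ .Ω3a) (hh : k ≠ .Ω3h) :
    ∃ o, k.SameSign o := by
  cases k <;> simp_all [Move.strands, Move.SameSign]

end ReidemeisterMoves

/-! ### The main theorem -/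

theorem mainTheorem4 (S : Finset ReidemeisterMoves.Move)
    (hS : ReidemeisterMoves.IsMinimalGenerating S) :
    ReidemeisterMoves.Move.Ω3a ∈ S ∨ ReidemeisterMoves.Move.Ω3h ∈ S := by
  open ReidemeisterMoves in
  by_contra! hn
  obtain ⟨hgen, hmin⟩ := hS
  obtain ⟨x, hx, hx1, hxo⟩ := hgen.exists_loop true
  obtain ⟨y, hy, hy1, hyo⟩ := hgen.exists_loop false
  obtain ⟨k, hk, hk2⟩ := hgen.exists_bigon
  obtain ⟨z, hz, hz3⟩ := hgen.exists_triangle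
  have hcard : S.card ≤ 4 := not_lt.1 fun h => hmin ⟨basicMoves, isGenerating_basicMoves, h⟩
  have hxy : x ≠ y := by rintro rfl; simp_all
  have hxk : x ≠ k := by rintro rfl; omega
  have hxz : x ≠ z := by rintro rfl; omega
  have hyk : y ≠ k := by rintro rfl; omega
  have hyz : y ≠ z := by rintro rfl; omega
  have hkz : k ≠ z := by rintro rfl; omega
  have hsub : ({x, y, k, z} : Finset Move) ⊆ S := by
    simp [Finset.insert_subset_iff, hx, hy, hk, hz]
  have hfour : ({x, y, k, z} : Finset Move).card = 4 := by
    simp [hxy, hxk, hxz, hyk, hyz, hkz]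
  -- Four distinct elements exhaust a set of at most four, so `k` and `z` are its only moves of
  -- types 2 and 3.
  have hS : S = {x, y, k, z} := (Finset.eq_of_subset_of_card_le hsub (by omega)).symm
  obtain ⟨o, ho⟩ := Move.exists_sameSign hz3 (fun h => hn.1 (h ▸ hz)) fun h => hn.2 (h ▸ hz)
  refine not_isGenerating_of_sameSign (o := o) (k := k) ?_ ?_ hgen
  · intro l hl hl2
    simp only [hS, Finset.mem_insert, Finset.mem_singleton] at hl
    obtain rfl | rfl | rfl | rfl := hl <;> first | rfl | omega
  · intro l hl hl3
    simp only [hS, Finset.mem_insert, Finset.mem_singleton] at hl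
    obtain rfl | rfl | rfl | rfl := hl <;> first | exact ho | omega
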